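/- Let $n\ge 0$. For a real symmetric $n\times n$ matrix $A$ and a real skew-symmetric $n\times n$ matrix $B$ let $\widehat H_{A,B}$ be the Weyl quantization (on $\mathcal S(\mathbb R^n)$, with $x_j$ acting by multiplication and $p_j$ by $-i\,\partial/\partial x_j$) of the quadratic Hamiltonian $$H_{A,B}(x,p)=\tfrac12\,(x,p)\begin{pmatrix}A&-B\\ B&A\end{pmatrix}\begin{pmatrix}x\\p\end{pmatrix},$$ and let $\exp(-it\widehat H_{A,B})$, $t\in\mathbb R$, be the strongly continuous one-parameter group of unitary operators on $L^2(\mathbb R^n)$ with derivative $-i\widehat H_{A,B}f$ at $t=0$ on every $f\in\mathcal S(\mathbb R^n)$. There is exactly one homomorphism $R$, $g\mapsto R_g$, from $U(n)$ to the group of unitary operators on $L^2(\mathbb R^n)$ such that $$R_{\exp(B+iA)}=\exp(-i\widehat H_{A,B})\,\exp(i\operatorname{tr}A/2)$$ for all such $A$ and $B$. Write complex differential forms on $\mathbb R^n$ as $\omega=\sum_I\omega_I\,dx^I$, so that forms with coefficients in $L^2(\mathbb R^n)$ or in $\mathcal S(\mathbb R^n)$ are elements of $L^2(\mathbb R^n)\otimes\Lambda(\mathbb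 C^n)$ or $\mathcal S(\mathbb R^n)\otimes\Lambda(\mathbb C^n)$. Let $\rho$ be the diagonal representation of $U(n)$ on the $L^2$ forms, $$\rho_g\Bigl(\sum_I\omega_I\,dx^I\Bigr)=\sum_I R_g(\omega_I)\,(g^*)^{-1}(dx^I),$$ where $(g^*)^{-1}$ is the automorphism of the complex exterior algebra $\Lambda(\mathbb C^n)$ with $(g^*)^{-1}dx^i=\sum_j (g^{-1})_{ij}\,dx^j$. Let $$\mathcal E=d+d^*+x\,dx\wedge{}+(x\,dx\wedge)^*,\qquad x\,dx=\sum_j x_j\,dx_j,$$ act on the complex forms with coefficients in $\mathcal S(\mathbb R^n)$, where the adjoints are taken with respect to the $L^2$ inner product for which the $dx^I$ are pointwise orthonormal; $\mathcal E$ maps even forms to odd forms. Then, for every $g\in U(n)$, the operator $\rho_g$ preserves the space of forms with Schwartz coefficients and its subspaces of even and of odd forms, and $$\rho_g\,\mathcal E\,\rho_g^{-1}=\mathcal E .$$ -/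

import Mathlib

open MeasureTheory SchwartzMap LineDeriv
open scoped TensorProduct Matrix

noncomputable section

namespace EulerUn

/-! ### Function spaces -/

/-- The Schwartz space `𝓢(ℝⁿ)` of complex valued functions. -/
abbrev Sch (n : ℕ) : Type := 𝓢(EuclideanSpace ℝ (Fin n), ℂ)

/-- The Hilbert space `L²(ℝⁿ)` of complex valued functions. -/
abbrev L2 (n : ℕ) : Type := Lp ℂ 2 (volume : Measure (EuclideanSpace ℝ (Fin n)))

/-- The inclusion of `𝓢(ℝⁿ)` into `L²(ℝⁿ)`. -/
def toL2 (n : ℕ) : Sch n →L[ℂ] L2 n := SchwartzMap.toLpCLM ℂ ℂ 2 volume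

/-- Multiplication by the coordinate `x_j`. -/
def mulX {n : ℕ} (j : Fin n) : Sch n →L[ℂ] Sch n :=
  SchwartzMap.smulLeftCLM ℂ (fun x : EuclideanSpace ℝ (Fin n) => ((x j : ℝ) : ℂ))

/-- The partial derivative `∂/∂x_j`. -/
def partialX {n : ℕ} (j : Fin n) : Sch n →L[ℂ] Sch n :=
  lineDerivOpCLM ℂ (Sch n) (EuclideanSpace.single j (1 : ℝ))

theorem hasTemperateGrowth_coord {n : ℕ} (j : Fin n) :
    (fun x : EuclideanSpace ℝ (Fin n) => ((x j : ℝ) : ℂ)).HasTemperateGrowth :=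
  (Complex.ofRealCLM.comp (EuclideanSpace.proj j : EuclideanSpace ℝ (Fin n) →L[ℝ] ℝ)).hasTemperateGrowth

theorem mulX_apply {n : ℕ} (j : Fin n) (f : Sch n) (x : EuclideanSpace ℝ (Fin n)) :
    mulX j f x = (x j : ℂ) * f x := by
  simp [mulX, SchwartzMap.smulLeftCLM_apply_apply (hasTemperateGrowth_coord j)]

theorem partialX_apply {n : ℕ} (j : Fin n) (f : Sch n) (x : EuclideanSpace ℝ (Fin n)) :
    partialX j f x = lineDeriv ℝ f x (EuclideanSpace.single j (1 : ℝ)) :=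
  SchwartzMap.lineDerivOp_apply _ f x

theorem inner_toL2 {n : ℕ} (f g : Sch n) :
    inner ℂ (toL2 n f) (toL2 n g) = ∫ x, g x * (starRingEnd ℂ) (f x) := by
  rw [MeasureTheory.L2.inner_def]
  refine integral_congr_ae ?_
  filter_upwards [f.coeFn_toLp 2 volume, g.coeFn_toLp 2 volume] with x hf hg
  simp [toL2, hf, hg]

/-- `x_j` is symmetric on `𝓢(ℝⁿ)`. -/
theorem inner_mulX {n : ℕ} (j : Fin n) (f g : Sch n) :
    inner ℂ (toL2 n (mulX j f)) (toL2 n g) = inner ℂ (toL2 n f) (toL2 n (mulX j g)) := by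
  simp only [inner_toL2, mulX_apply, map_mul, Complex.conj_ofReal]
  exact integral_congr_ae (Filter.Eventually.of_forall fun x => by ring)

/-- `∂/∂x_j` is antisymmetric on `𝓢(ℝⁿ)`. -/
theorem inner_partialX {n : ℕ} (j : Fin n) (f g : Sch n) :
    inner ℂ (toL2 n (partialX j f)) (toL2 n g) = inner ℂ (toL2 n f) (toL2 n (-partialX j g)) := by
  have h := SchwartzMap.integral_bilinear_lineDerivOp_right_eq_neg_left
    (μ := (volume : Measure (EuclideanSpace ℝ (Fin n)))) f g
    ((ContinuousLinearMap.mul ℝ ℂ).comp (Complex.conjCLE : ℂ →L[ℝ] ℂ))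
    (EuclideanSpace.single j (1 : ℝ))
  have h1 : inner ℂ (toL2 n (partialX j f)) (toL2 n g)
      = ∫ x, (starRingEnd ℂ) (partialX j f x) * g x := by
    rw [inner_toL2]; simp only [mul_comm]
  have h2 : inner ℂ (toL2 n f) (toL2 n (partialX j g))
      = ∫ x, (starRingEnd ℂ) (f x) * partialX j g x := by
    rw [inner_toL2]; simp only [mul_comm]
  rw [map_neg, inner_neg_right, h1, h2]
  exact (neg_eq_iff_eq_neg.mpr h).symm

/-! ### Exponentials of quadratic Hamiltonians -/

/-- The quantizations of the phase space coordinates `(x, p)`: the coordinate `x_j` acts by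
multiplication and `p_j` acts by `-i ∂/∂x_j`. -/
def canonicalOp {n : ℕ} : Fin n ⊕ Fin n → (Sch n →L[ℂ] Sch n)
  | Sum.inl j => mulX j
  | Sum.inr j => (-Complex.I) • partialX j

/-- Weyl quantization of the homogeneous quadratic Hamiltonian
`H(x, p) = ½ (x, p) M (x, p)ᵗ`: each monomial in the phase space coordinates is replaced by the
symmetrized product of the corresponding operators. -/
def weylQuadratic {n : ℕ} (M : Matrix (Fin n ⊕ Fin n) (Fin n ⊕ Fin n) ℝ) : Sch n →L[ℂ] Sch n :=
  (1 / 2 : ℂ) • ∑ a, ∑ b, (M a b : ℂ) •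
    ((1 / 2 : ℂ) • ((canonicalOp a).comp (canonicalOp b) + (canonicalOp b).comp (canonicalOp a)))

/-- `U t = exp(-i t H)`: a strongly continuous one-parameter group of unitary operators on
`L²(ℝⁿ)` with `d/dt U(t) f = -i H f` at `t = 0` for all Schwartz functions `f`. (For the Weyl
quantization `H` of a real quadratic Hamiltonian, which is essentially self-adjoint on `𝓢(ℝⁿ)`,
there is exactly one such group.) -/
structure IsSchrodingerGroup {n : ℕ} (H : Sch n →L[ℂ] Sch n) (U : ℝ → (L2 n ≃ₗᵢ[ℂ] L2 n)) :
    Prop where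
  map_zero : U 0 = 1
  map_add : ∀ s t : ℝ, U (s + t) = U s * U t
  continuous : ∀ f : L2 n, Continuous fun t : ℝ => U t f
  hasDerivAt : ∀ f : Sch n,
    HasDerivAt (fun t : ℝ => U t (toL2 n f)) ((-Complex.I) • toL2 n (H f)) 0

/-- `R` is the metaplectic representation of the unitary group `U(n)` on `L²(ℝⁿ)`, i.e. it is a
homomorphism with `R (exp (B + iA)) = exp(-iĤ) · exp(i tr A / 2)` for all real `A` symmetric and
`B` skew-symmetric, where `Ĥ` is the Weyl quantization of
`H(x, p) = ½ (x, p) [[A, -B], [B, A]] (x, p)ᵗ`. -/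
def IsMetaplecticRep {n : ℕ} (R : Matrix.unitaryGroup (Fin n) ℂ →* (L2 n ≃ₗᵢ[ℂ] L2 n)) : Prop :=
  ∀ A B : Matrix (Fin n) (Fin n) ℝ, Aᵀ = A → Bᵀ = -B →
    ∀ g : Matrix.unitaryGroup (Fin n) ℂ,
      (g : Matrix (Fin n) (Fin n) ℂ) =
        NormedSpace.exp (B.map Complex.ofReal + Complex.I • A.map Complex.ofReal) →
      ∃ U : ℝ → (L2 n ≃ₗᵢ[ℂ] L2 n),
        IsSchrodingerGroup (weylQuadratic (Matrix.fromBlocks A (-B) B A)) U ∧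
        ∀ f : L2 n, R g f = Complex.exp (Complex.I * (A.trace : ℂ) / 2) • U 1 f

/-! ### Complex differential forms -/

/-- The algebra `Λ(ℂⁿ) = Λ(ℝⁿ) ⊗ ℂ` of constant complex forms on `ℝⁿ`; a vector `c : Fin n → ℂ`
stands for the covector `∑ i, c i dx^i`. -/
abbrev Ext (n : ℕ) : Type := ExteriorAlgebra ℂ (Fin n → ℂ)

/-- The covector `dx^j`. -/
def dx {n : ℕ} (j : Fin n) : Ext n := ExteriorAlgebra.ι ℂ (Pi.single j 1)

/-- The basis `dx^I` of `Λ(ℂⁿ)`, where `I` runs over the subsets of `{1, …, n}` and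
`dx^I` is the product of the `dx^i`, `i ∈ I`, in increasing order. -/
def dxBasis (n : ℕ) : Module.Basis (Finset (Fin n)) ℂ (Ext n) :=
  (Pi.basisFun ℂ (Fin n)).ExteriorAlgebra

/-- Exterior multiplication `α ↦ dx^j ∧ α`. -/
def wedge {n : ℕ} (j : Fin n) : Ext n →ₗ[ℂ] Ext n := LinearMap.mulLeft ℂ (dx j)

/-- Contraction of a form with the coordinate vector field `∂/∂x_j`. -/
def contr {n : ℕ} (j : Fin n) : Ext n →ₗ[ℂ] Ext n :=
  CliffordAlgebra.contractLeft (Q := (0 : QuadraticForm ℂ (Fin n → ℂ))) (LinearMap.proj j)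

/-- The Hermitian inner product on `Λ(ℂⁿ)` for which the `dx^I` are orthonormal
(antilinear in the first argument). -/
def extInner {n : ℕ} (α β : Ext n) : ℂ :=
  ∑ I, (starRingEnd ℂ) ((dxBasis n).coord I α) * (dxBasis n).coord I β

/-- Forms `∑_I ω_I dx^I` with coefficients `ω_I ∈ L²(ℝⁿ)`. -/
abbrev L2Forms (n : ℕ) : Type := L2 n ⊗[ℂ] Ext n

/-- Forms `∑_I ω_I dx^I` with coefficients `ω_I ∈ 𝓢(ℝⁿ)`. -/
abbrev SchForms (n : ℕ) : Type := Sch n ⊗[ℂ] Ext n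

/-- The inclusion of the Schwartz forms into the `L²` forms. -/
def formsToL2 (n : ℕ) : SchForms n →ₗ[ℂ] L2Forms n :=
  TensorProduct.map (toL2 n).toLinearMap LinearMap.id

/-- The coefficient `ω_I` of a form `ω = ∑_I ω_I dx^I`. -/
def coeff {n : ℕ} (I : Finset (Fin n)) : L2Forms n →ₗ[ℂ] L2 n :=
  (TensorProduct.rid ℂ (L2 n)).toLinearMap ∘ₗ
    TensorProduct.map LinearMap.id ((dxBasis n).coord I)

/-- The `L²` inner product of forms: `∑_I ⟨u_I, v_I⟩` (antilinear in the first argument). -/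
def formInner {n : ℕ} (u v : L2Forms n) : ℂ := ∑ I, inner ℂ (coeff I u) (coeff I v)

/-- The Schwartz forms with values in `Λ^ev`. -/
def evenForms (n : ℕ) : Submodule ℂ (SchForms n) :=
  LinearMap.range (TensorProduct.map (LinearMap.id : Sch n →ₗ[ℂ] Sch n)
    (CliffordAlgebra.evenOdd (0 : QuadraticForm ℂ (Fin n → ℂ)) 0).subtype)

/-- The Schwartz forms with values in `Λ^odd`. -/
def oddForms (n : ℕ) : Submodule ℂ (SchForms n) :=
  LinearMap.range (TensorProduct.map (LinearMap.id : Sch n →ₗ[ℂ] Sch n)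
    (CliffordAlgebra.evenOdd (0 : QuadraticForm ℂ (Fin n → ℂ)) 1).subtype)

/-! ### The Euler operator -/

/-- The exterior derivative `d (f α) = ∑_j (∂f/∂x_j) dx^j ∧ α`. -/
def extD (n : ℕ) : SchForms n →ₗ[ℂ] SchForms n :=
  ∑ j, TensorProduct.map (partialX j).toLinearMap (wedge j)

/-- The codifferential `d*`, the formal `L²` adjoint of `d` (see `formInner_extD`). -/
def extDStar (n : ℕ) : SchForms n →ₗ[ℂ] SchForms n :=
  -∑ j, TensorProduct.map (partialX j).toLinearMap (contr j)

/-- Exterior multiplication by the one-form `x dx = ∑_j x_j dx^j`. -/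
def xdxWedge (n : ℕ) : SchForms n →ₗ[ℂ] SchForms n :=
  ∑ j, TensorProduct.map (mulX j).toLinearMap (wedge j)

/-- The `L²` adjoint of exterior multiplication by `x dx` (see `formInner_xdxWedge`). -/
def xdxWedgeStar (n : ℕ) : SchForms n →ₗ[ℂ] SchForms n :=
  ∑ j, TensorProduct.map (mulX j).toLinearMap (contr j)

/-- The modified Euler operator `𝓔 = d + d* + x dx ∧ + (x dx ∧)*` on Schwartz forms. -/
def euler (n : ℕ) : SchForms n →ₗ[ℂ] SchForms n :=
  extD n + extDStar n + xdxWedge n + xdxWedgeStar n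

/-! ### The diagonal representation -/

/-- The natural action `α ↦ (g*)⁻¹ α` of `U(n)` on `Λ(ℂⁿ)`: the pullback by `g⁻¹`, that is, the
algebra automorphism with `dx^i ↦ ∑_j (g⁻¹)_{ij} dx^j`. -/
def formRep (n : ℕ) : Representation ℂ (Matrix.unitaryGroup (Fin n) ℂ) (Ext n) where
  toFun g := (ExteriorAlgebra.map
    (Matrix.vecMulLinear ((g⁻¹ : Matrix.unitaryGroup (Fin n) ℂ) :
      Matrix (Fin n) (Fin n) ℂ))).toLinearMap
  map_one' := by
    have h : Matrix.vecMulLinear (1 : Matrix (Fin n) (Fin n) ℂ) = LinearMap.id := by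
      refine LinearMap.ext fun c => ?_
      simp
    simp [h, ExteriorAlgebra.map_id]
    rfl
  map_mul' g h := by
    have e : Matrix.vecMulLinear (((g * h)⁻¹ : Matrix.unitaryGroup (Fin n) ℂ) :
          Matrix (Fin n) (Fin n) ℂ) =
        (Matrix.vecMulLinear ((g⁻¹ : Matrix.unitaryGroup (Fin n) ℂ) :
          Matrix (Fin n) (Fin n) ℂ)).comp
        (Matrix.vecMulLinear ((h⁻¹ : Matrix.unitaryGroup (Fin n) ℂ) :
          Matrix (Fin n) (Fin n) ℂ)) := by
      refine LinearMap.ext fun c => ?_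
      rw [LinearMap.comp_apply]
      simp only [Matrix.vecMulLinear_apply, Matrix.vecMul_vecMul, mul_inv_rev, Submonoid.coe_mul]
    rw [e, ← ExteriorAlgebra.map_comp_map]
    rfl

/-- A unitary representation on `L²(ℝⁿ)`, as a representation by linear maps. -/
def scalarRep {n : ℕ} (R : Matrix.unitaryGroup (Fin n) ℂ →* (L2 n ≃ₗᵢ[ℂ] L2 n)) :
    Representation ℂ (Matrix.unitaryGroup (Fin n) ℂ) (L2 n) where
  toFun g := (R g).toLinearEquiv.toLinearMap
  map_one' := by ext1 f; simp
  map_mul' g h := by ext1 f; simp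

/-- The diagonal representation `ρ_g (∑_I ω_I dx^I) = ∑_I R_g(ω_I) (g*)⁻¹ dx^I`. -/
def rho {n : ℕ} (R : Matrix.unitaryGroup (Fin n) ℂ →* (L2 n ≃ₗᵢ[ℂ] L2 n)) :
    Representation ℂ (Matrix.unitaryGroup (Fin n) ℂ) (L2Forms n) :=
  (scalarRep R).tprod (formRep n)

/-! ### Consistency of the definitions -/

theorem formRep_dx {n : ℕ} (g : Matrix.unitaryGroup (Fin n) ℂ) (i : Fin n) :
    formRep n g (dx i) =
      ∑ j, ((g⁻¹ : Matrix.unitaryGroup (Fin n) ℂ) : Matrix (Fin n) (Fin n) ℂ) i j • dx j := by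
  change ExteriorAlgebra.map _ (ExteriorAlgebra.ι ℂ _) = _
  rw [ExteriorAlgebra.map_apply_ι]
  simp only [dx, ← map_smul, ← map_sum]
  congr 1
  ext k
  simp [Finset.sum_apply, Pi.single_apply]

theorem contr_dx_mul {n : ℕ} (j i : Fin n) (β : Ext n) :
    contr j (dx i * β) = (if j = i then β else 0) - dx i * contr j β := by
  have h := CliffordAlgebra.contractLeft_ι_mul (Q := (0 : QuadraticForm ℂ (Fin n → ℂ)))
    (LinearMap.proj j) (Pi.single i 1) β
  refine h.trans ?_
  congr 1
  by_cases hj : j = i <;> simp [hj]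

theorem contr_one {n : ℕ} (j : Fin n) : contr j (1 : Ext n) = 0 :=
  CliffordAlgebra.contractLeft_one (Q := (0 : QuadraticForm ℂ (Fin n → ℂ))) (LinearMap.proj j)

theorem dxBasis_eq {n : ℕ} (I : Finset (Fin n)) :
    dxBasis n I = (List.ofFn fun i : Fin I.card => dx (I.orderEmbOfFin rfl i)).prod := by
  have h := ExteriorAlgebra.basis_apply_ofCard (Pi.basisFun ℂ (Fin n)) (s := I) rfl
  refine h.trans ?_
  refine (ExteriorAlgebra.ιMulti_apply _).trans ?_
  simp [dx, Set.powersetCard.ofFinEmbEquiv_symm_apply]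

theorem contr_dxBasis {n : ℕ} {j : Fin n} {I : Finset (Fin n)} (h : j ∉ I) :
    contr j (dxBasis n I) = 0 := by
  have key : ∀ l : List (Fin n), j ∉ l → contr j ((l.map dx).prod : Ext n) = 0 := by
    intro l
    induction l with
    | nil => intro _; simpa using contr_one j
    | cons a l ih =>
      intro hl
      rw [List.mem_cons, not_or] at hl
      rw [List.map_cons, List.prod_cons, contr_dx_mul, if_neg hl.1, ih hl.2]
      simp
  have := key (List.ofFn fun i : Fin I.card => I.orderEmbOfFin rfl i) (by
    rw [List.mem_ofFn]
    rintro ⟨i, rfl⟩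
    exact h (I.orderEmbOfFin_mem rfl i))
  rw [dxBasis_eq]
  rwa [List.map_ofFn] at this

theorem dxBasis_singleton {n : ℕ} (j : Fin n) : dxBasis n {j} = dx j := by
  have h : ∀ i, ({j} : Finset (Fin n)).orderEmbOfFin rfl i = j := fun i =>
    Finset.mem_singleton.mp (Finset.orderEmbOfFin_mem _ rfl i)
  rw [dxBasis_eq]
  simp only [h]
  simp

theorem wedge_dxBasis_of_mem {n : ℕ} {j : Fin n} {I : Finset (Fin n)} (h : j ∈ I) :
    wedge j (dxBasis n I) = 0 := by
  have := ExteriorAlgebra.basis_mul_of_not_disjoint (Pi.basisFun ℂ (Fin n))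
    (Set.powersetCard.ofCard (s := {j}) rfl) (Set.powersetCard.ofCard (s := I) rfl)
    (by simpa using h)
  rw [wedge, LinearMap.mulLeft_apply, ← dxBasis_singleton]
  exact this

theorem wedge_dxBasis_of_notMem {n : ℕ} {j : Fin n} {I : Finset (Fin n)} (h : j ∉ I) :
    ∃ ε : ℤˣ, wedge j (dxBasis n I) = ((ε : ℤ) : ℂ) • dxBasis n (insert j I) := by
  have hd : Disjoint ({j} : Finset (Fin n)) I := by simpa using h
  have := ExteriorAlgebra.basis_mul_of_disjoint (Pi.basisFun ℂ (Fin n))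
    (Set.powersetCard.ofCard (s := {j}) rfl) (Set.powersetCard.ofCard (s := I) rfl) hd
  refine ⟨(Set.powersetCard.permOfDisjoint (s := Set.powersetCard.ofCard (s := {j}) rfl)
    (t := Set.powersetCard.ofCard (s := I) rfl) hd).sign, ?_⟩
  rw [wedge, LinearMap.mulLeft_apply, ← dxBasis_singleton]
  refine Eq.trans this ?_
  rw [Units.smul_def, ← Int.cast_smul_eq_zsmul ℂ]
  have e : ((Set.powersetCard.disjUnion (s := Set.powersetCard.ofCard (s := {j}) rfl)
      (t := Set.powersetCard.ofCard (s := I) rfl) hd : Set.powersetCard (Fin n) _) :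
      Finset (Fin n)) = insert j I := by
    ext i
    refine (Finset.mem_disjUnion (h := hd)).trans ?_
    simp
  rw [e]
  rfl

theorem contr_dxBasis_insert {n : ℕ} {j : Fin n} {I : Finset (Fin n)} {ε : ℤˣ} (h : j ∉ I)
    (hε : wedge j (dxBasis n I) = ((ε : ℤ) : ℂ) • dxBasis n (insert j I)) :
    contr j (dxBasis n (insert j I)) = ((ε : ℤ) : ℂ) • dxBasis n I := by
  have hs : ((ε : ℤ) : ℂ) * ((ε : ℤ) : ℂ) = 1 := by
    rcases Int.units_eq_one_or ε with rfl | rfl <;> simp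
  have h1 : dxBasis n (insert j I) = ((ε : ℤ) : ℂ) • wedge j (dxBasis n I) := by
    rw [hε, smul_smul, hs, one_smul]
  rw [h1, map_smul, wedge, LinearMap.mulLeft_apply, contr_dx_mul, if_pos rfl, contr_dxBasis h,
    mul_zero, sub_zero]

theorem coord_wedge {n : ℕ} (j : Fin n) (J K : Finset (Fin n)) :
    (starRingEnd ℂ) ((dxBasis n).coord K (wedge j (dxBasis n J))) =
      (dxBasis n).coord J (contr j (dxBasis n K)) := by
  have hco : ∀ (I L : Finset (Fin n)), (dxBasis n).coord I (dxBasis n L) = if L = I then 1 else 0 :=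
    fun I L => by rw [Module.Basis.coord_apply, Module.Basis.repr_self, Finsupp.single_apply]
  by_cases hK : j ∈ K
  · have hj : j ∉ K.erase j := Finset.notMem_erase j K
    obtain ⟨ε, hε⟩ := wedge_dxBasis_of_notMem hj
    have hc := contr_dxBasis_insert hj hε
    rw [Finset.insert_erase hK] at hc hε
    rw [hc, map_smul, hco]
    by_cases hJ : j ∈ J
    · have : K.erase j ≠ J := fun e => hj (e ▸ hJ)
      simp [wedge_dxBasis_of_mem hJ, this]
    · by_cases e : K.erase j = J
      · subst e
        rw [hε, map_smul, hco]
        simp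
      · obtain ⟨ε', hε'⟩ := wedge_dxBasis_of_notMem hJ
        have : insert j J ≠ K := fun h => e (by rw [← h, Finset.erase_insert hJ])
        rw [hε', map_smul, hco, if_neg this, if_neg e]
        simp
  · rw [contr_dxBasis hK, map_zero]
    by_cases hJ : j ∈ J
    · simp [wedge_dxBasis_of_mem hJ]
    · obtain ⟨ε', hε'⟩ := wedge_dxBasis_of_notMem hJ
      have : insert j J ≠ K := fun h => hK (h ▸ Finset.mem_insert_self j J)
      rw [hε', map_smul, hco, if_neg this]
      simp

/-- Contraction with `∂/∂x_j` is the adjoint of exterior multiplication by `dx^j`. -/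
theorem extInner_wedge {n : ℕ} (j : Fin n) (α β : Ext n) :
    extInner (wedge j α) β = extInner α (contr j β) := by
  have hα : ∀ K, (dxBasis n).coord K (wedge j α) =
      ∑ J, (dxBasis n).coord J α * (dxBasis n).coord K (wedge j (dxBasis n J)) := fun K => by
    conv_lhs => rw [← (dxBasis n).sum_repr α]
    simp only [map_sum, map_smul, smul_eq_mul, Module.Basis.coord_apply]
  have hβ : ∀ J, (dxBasis n).coord J (contr j β) =
      ∑ K, (dxBasis n).coord K β * (dxBasis n).coord J (contr j (dxBasis n K)) := fun J => by
    conv_lhs => rw [← (dxBasis n).sum_repr β]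
    simp only [map_sum, map_smul, smul_eq_mul, Module.Basis.coord_apply]
  simp only [extInner, hα, hβ, map_sum, map_mul, coord_wedge, Finset.sum_mul, Finset.mul_sum]
  rw [Finset.sum_comm]
  exact Finset.sum_congr rfl fun J _ => Finset.sum_congr rfl fun K _ => by ring

theorem coeff_tmul {n : ℕ} (I : Finset (Fin n)) (f : L2 n) (α : Ext n) :
    coeff I (f ⊗ₜ[ℂ] α) = (dxBasis n).coord I α • f := by
  simp [coeff]

theorem formInner_tmul {n : ℕ} (f g : L2 n) (α β : Ext n) :
    formInner (f ⊗ₜ[ℂ] α) (g ⊗ₜ[ℂ] β) = extInner α β * inner ℂ f g := by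
  simp only [formInner, extInner, coeff_tmul, inner_smul_left, inner_smul_right, Finset.sum_mul]
  exact Finset.sum_congr rfl fun I _ => by ring

theorem formInner_add_left {n : ℕ} (u u' v : L2Forms n) :
    formInner (u + u') v = formInner u v + formInner u' v := by
  simp [formInner, inner_add_left, Finset.sum_add_distrib]

theorem formInner_add_right {n : ℕ} (u v v' : L2Forms n) :
    formInner u (v + v') = formInner u v + formInner u v' := by
  simp [formInner, inner_add_right, Finset.sum_add_distrib]

theorem formInner_zero_left {n : ℕ} (v : L2Forms n) : formInner 0 v = 0 := by
  simp [formInner]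

theorem formInner_zero_right {n : ℕ} (u : L2Forms n) : formInner u 0 = 0 := by
  simp [formInner]

theorem formInner_sum_left {n : ℕ} {ι : Type} (s : Finset ι) (u : ι → L2Forms n) (v : L2Forms n) :
    formInner (∑ i ∈ s, u i) v = ∑ i ∈ s, formInner (u i) v := by
  classical
  induction s using Finset.induction_on with
  | empty => simp [formInner_zero_left]
  | insert a s ha ih => rw [Finset.sum_insert ha, Finset.sum_insert ha, formInner_add_left, ih]

theorem formInner_sum_right {n : ℕ} {ι : Type} (s : Finset ι) (u : L2Forms n) (v : ι → L2Forms n) :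
    formInner u (∑ i ∈ s, v i) = ∑ i ∈ s, formInner u (v i) := by
  classical
  induction s using Finset.induction_on with
  | empty => simp [formInner_zero_right]
  | insert a s ha ih => rw [Finset.sum_insert ha, Finset.sum_insert ha, formInner_add_right, ih]

theorem formInner_map {n : ℕ} {S T : Sch n →ₗ[ℂ] Sch n} {a b : Ext n →ₗ[ℂ] Ext n}
    (hS : ∀ f g, inner ℂ (toL2 n (S f)) (toL2 n g) = inner ℂ (toL2 n f) (toL2 n (T g)))
    (ha : ∀ α β, extInner (a α) β = extInner α (b β)) (u v : SchForms n) :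
    formInner (formsToL2 n (TensorProduct.map S a u)) (formsToL2 n v) =
      formInner (formsToL2 n u) (formsToL2 n (TensorProduct.map T b v)) := by
  induction u using TensorProduct.induction_on with
  | zero => simp [formInner_zero_left]
  | add u u' hu hu' => simp only [map_add, formInner_add_left, hu, hu']
  | tmul f α =>
    induction v using TensorProduct.induction_on with
    | zero => simp [formInner_zero_right]
    | add v v' hv hv' => simp only [map_add, formInner_add_right, hv, hv']
    | tmul g β =>
      simp only [formsToL2, TensorProduct.map_tmul, formInner_tmul, LinearMap.id_apply, ha]
      congr 1
      exact hS f g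

/-- `d*` is the formal `L²` adjoint of `d`. -/
theorem formInner_extD {n : ℕ} (u v : SchForms n) :
    formInner (formsToL2 n (extD n u)) (formsToL2 n v) =
      formInner (formsToL2 n u) (formsToL2 n (extDStar n v)) := by
  have e : extDStar n = ∑ j, TensorProduct.map (-(partialX j).toLinearMap) (contr j) := by
    rw [extDStar, ← Finset.sum_neg_distrib]
    refine Finset.sum_congr rfl fun j _ => ?_
    ext; simp [TensorProduct.neg_tmul]
  rw [e]
  simp only [extD, LinearMap.sum_apply, map_sum, formInner_sum_left, formInner_sum_right]
  exact Finset.sum_congr rfl fun j _ =>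
    formInner_map (fun f g => inner_partialX j f g) (extInner_wedge j) u v

/-- `(x dx ∧)*` is the `L²` adjoint of `x dx ∧`. -/
theorem formInner_xdxWedge {n : ℕ} (u v : SchForms n) :
    formInner (formsToL2 n (xdxWedge n u)) (formsToL2 n v) =
      formInner (formsToL2 n u) (formsToL2 n (xdxWedgeStar n v)) := by
  simp only [xdxWedge, xdxWedgeStar, LinearMap.sum_apply, map_sum, formInner_sum_left,
    formInner_sum_right]
  exact Finset.sum_congr rfl fun j _ =>
    formInner_map (fun f g => inner_mulX j f g) (extInner_wedge j) u v

theorem wedge_mem_odd {n : ℕ} (j : Fin n) {α : Ext n}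
    (h : α ∈ CliffordAlgebra.evenOdd (0 : QuadraticForm ℂ (Fin n → ℂ)) 0) :
    wedge j α ∈ CliffordAlgebra.evenOdd (0 : QuadraticForm ℂ (Fin n → ℂ)) 1 := by
  have := Submodule.mul_mem_mul (CliffordAlgebra.ι_mem_evenOdd_one
    (0 : QuadraticForm ℂ (Fin n → ℂ)) (Pi.single j 1)) h
  exact CliffordAlgebra.evenOdd_mul_le _ 1 0 this

theorem contr_mem_odd {n : ℕ} (j : Fin n) {α : Ext n}
    (h : α ∈ CliffordAlgebra.evenOdd (0 : QuadraticForm ℂ (Fin n → ℂ)) 0) :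
    contr j α ∈ CliffordAlgebra.evenOdd (0 : QuadraticForm ℂ (Fin n → ℂ)) 1 := by
  induction α, h using CliffordAlgebra.even_induction with
  | algebraMap r =>
    rw [contr, CliffordAlgebra.contractLeft_algebraMap]
    exact zero_mem _
  | add x y hx hy ihx ihy =>
    rw [map_add]
    exact add_mem ihx ihy
  | ι_mul_ι_mul m₁ m₂ x hx ih =>
    have hm := CliffordAlgebra.ι_mem_evenOdd_one (0 : QuadraticForm ℂ (Fin n → ℂ))
    rw [contr] at ih ⊢
    rw [mul_assoc, CliffordAlgebra.contractLeft_ι_mul, CliffordAlgebra.contractLeft_ι_mul, mul_sub,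
      mul_smul_comm]
    refine sub_mem (Submodule.smul_mem _ _ ?_) (sub_mem (Submodule.smul_mem _ _ ?_) ?_)
    · exact CliffordAlgebra.evenOdd_mul_le _ 1 0 (Submodule.mul_mem_mul (hm m₂) hx)
    · exact CliffordAlgebra.evenOdd_mul_le _ 1 0 (Submodule.mul_mem_mul (hm m₁) hx)
    · exact CliffordAlgebra.evenOdd_mul_le _ 1 0 (Submodule.mul_mem_mul (hm m₁)
        (CliffordAlgebra.evenOdd_mul_le _ 1 1 (Submodule.mul_mem_mul (hm m₂) ih)))

theorem map_mem_oddForms {n : ℕ} (S : Sch n →ₗ[ℂ] Sch n) (a : Ext n →ₗ[ℂ] Ext n)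
    (ha : ∀ α ∈ CliffordAlgebra.evenOdd (0 : QuadraticForm ℂ (Fin n → ℂ)) 0,
      a α ∈ CliffordAlgebra.evenOdd (0 : QuadraticForm ℂ (Fin n → ℂ)) 1)
    {u : SchForms n} (hu : u ∈ evenForms n) : TensorProduct.map S a u ∈ oddForms n := by
  obtain ⟨w, rfl⟩ := hu
  induction w using TensorProduct.induction_on with
  | zero => simp
  | add w w' h h' => simpa only [map_add] using add_mem h h'
  | tmul f α => exact ⟨S f ⊗ₜ ⟨a α, ha α α.2⟩, by simp⟩

/-- The Euler operator maps even forms to odd forms. -/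
theorem euler_even {n : ℕ} {u : SchForms n} (hu : u ∈ evenForms n) : euler n u ∈ oddForms n := by
  have hw (S : Fin n → (Sch n →L[ℂ] Sch n)) :
      (∑ j, TensorProduct.map (S j).toLinearMap (wedge j)) u ∈ oddForms n := by
    rw [LinearMap.sum_apply]
    exact sum_mem fun j _ => map_mem_oddForms _ _ (fun _ h => wedge_mem_odd j h) hu
  have hc (S : Fin n → (Sch n →L[ℂ] Sch n)) :
      (∑ j, TensorProduct.map (S j).toLinearMap (contr j)) u ∈ oddForms n := by
    rw [LinearMap.sum_apply]
    exact sum_mem fun j _ => map_mem_oddForms _ _ (fun _ h => contr_mem_odd j h) hu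
  exact add_mem (add_mem (add_mem (hw _) (neg_mem (hc _))) (hw _)) (hc _)

end EulerUn

end

noncomputable section

namespace EulerUn

/-! ### The Gaussian -/

section Gaussian

variable {E : Type} [NormedAddCommGroup E] [InnerProductSpace ℝ E]

/-! The proof works in the Fock model. Put `a_j = x_j + ∂_j` (`lower`) and `a_j† = x_j - ∂_j`
(`raise`), so that `[a_i, a_j†] = 2 δ_ij` and each `a_j` kills the Gaussian. A polynomial `p` gives
the Hermite function `p(a†) exp(-|x|²/2)`; on these, `a_j†` is multiplication by `X_j` and `a_j` is
`2 ∂/∂X_j`. They are dense in `L²`.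

For `Z = B + iA` the Weyl quantization satisfies `-iĤ = -i tr A / 2 + ½ ∑ conj (Z_kj) a_k† a_j`
(`weylQuadratic_eq_ladder`). On polynomials the last sum is the derivation `∑ conj (Z_kj) X_k ∂_j`,
the generator of the substitutions `X_j ↦ ∑_k conj (exp (tZ)_kj) X_k`. The phase `exp(i tr A / 2)`
removes the constant, so `R_g` must be the substitution by `g`. Substitution by a unitary matrix is
isometric (`inner_polySubst`) and hence extends to `L²` as a homomorphism `metaRep`. It has the
defining property (`isSchrodingerGroup_of_hermiteL2`) and is the only such homomorphism, because a
Schrödinger group is determined once one with the same generator preserves the Hermite functions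
(`IsSchrodingerGroup.eq_of_hermiteL2`) and every unitary matrix is an exponential.

`R_g` preserves Schwartz functions (`exists_metaRep_toL2`): the Hermite components of a Schwartz
function decay faster than every power of the degree, `R_g` preserves degrees and norms, and
Schwartz seminorms of Hermite functions are bounded by their `L²` norms up to a power of the degree.

Finally `𝓔 = ∑_j (a_j ⊗ dx^j∧ + a_j† ⊗ ι_j)`, with `ι_j` the contraction by `∂/∂x_j`. Under `R_g`
the `a_j` transform with the matrix `conj g`, as the `dx^j∧` do under `(g*)⁻¹`, while the `a_j†` and
the `ι_j` both transform with `g`; the coefficients pass across the tensor product, so `𝓔` is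
invariant. -/

theorem _root_.Function.HasTemperateGrowth.fderiv {F : Type} [NormedAddCommGroup F]
    [NormedSpace ℝ F] {q : E → F} (hq : q.HasTemperateGrowth) :
    (fderiv ℝ q).HasTemperateGrowth := by
  refine ⟨hq.1.fderiv_right (by simp), fun l => ?_⟩
  obtain ⟨k, C, h⟩ := hq.2 (l + 1)
  exact ⟨k, C, fun x => by rw [norm_iteratedFDeriv_fderiv]; exact h x⟩

theorem hasFDerivAt_gaussian (x : E) :
    HasFDerivAt (fun x : E => Real.exp (-‖x‖ ^ 2 / 2))
      (-(Real.exp (-‖x‖ ^ 2 / 2)) • innerSL ℝ x) x := by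
  have h := ((hasStrictFDerivAt_norm_sq x).hasFDerivAt.neg.mul_const (1 / 2 : ℝ)).exp
  convert h using 1
  · ext y; congr 1; simp only [Pi.neg_apply]; ring
  · ext y; simp [div_eq_mul_inv]

theorem contDiff_gaussian : ContDiff ℝ ⊤ (fun x : E => Real.exp (-‖x‖ ^ 2 / 2)) :=
  ((contDiff_norm_sq ℝ).neg.div_const 2).exp

/-- The derivative of `exp(-|x|²/2) q` is `exp(-|x|²/2)` times `q' - ⟨x, ·⟩ q`, again of temperate
growth. Letting `q` and its target space vary makes the induction close. -/
theorem norm_iteratedFDeriv_gaussian_smul_le (l : ℕ) :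
    ∀ {F : Type} [NormedAddCommGroup F] [NormedSpace ℝ F] {q : E → F},
    q.HasTemperateGrowth → ∃ (C : ℝ) (m : ℕ), 0 ≤ C ∧ ∀ x : E,
      ‖iteratedFDeriv ℝ l (fun x : E => Real.exp (-‖x‖ ^ 2 / 2) • q x) x‖ ≤
        C * (1 + ‖x‖) ^ m * Real.exp (-‖x‖ ^ 2 / 2) := by
  induction l with
  | zero =>
    intro F _ _ q hq
    obtain ⟨k, C, h⟩ := hq.2 0
    have hC : 0 ≤ C := by
      have := (norm_nonneg _).trans (h 0)
      simpa using this
    refine ⟨C, k, hC, fun x => ?_⟩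
    have := h x
    rw [norm_iteratedFDeriv_zero] at this ⊢
    rw [norm_smul, Real.norm_of_nonneg (Real.exp_pos _).le, mul_comm]
    gcongr
  | succ l ih =>
    intro F _ _ q hq
    have h2 : (fun x : E => fderiv ℝ q x -
        ContinuousLinearMap.smulRightL ℝ E F (innerSL ℝ x) (q x)).HasTemperateGrowth :=
      hq.fderiv.sub ((ContinuousLinearMap.smulRightL ℝ E F).bilinear_hasTemperateGrowth
        (innerSL ℝ).hasTemperateGrowth hq)
    obtain ⟨C, m, hC, h⟩ := ih h2
    refine ⟨C, m, hC, fun x => ?_⟩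
    have e : fderiv ℝ (fun x : E => Real.exp (-‖x‖ ^ 2 / 2) • q x) = fun x =>
        Real.exp (-‖x‖ ^ 2 / 2) • (fderiv ℝ q x -
          ContinuousLinearMap.smulRightL ℝ E F (innerSL ℝ x) (q x)) := by
      ext1 y
      have hd : DifferentiableAt ℝ q y := (hq.1.differentiable (by simp)) y
      rw [((hasFDerivAt_gaussian y).fun_smul hd.hasFDerivAt).fderiv]
      ext z
      simp [smul_smul, sub_eq_add_neg]
    rw [← norm_iteratedFDeriv_fderiv, e]
    exact h x

theorem pow_mul_exp_neg_sq_le (N : ℕ) : ∃ C : ℝ, ∀ r : ℝ, 0 ≤ r →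
    (1 + r) ^ N * Real.exp (-r ^ 2 / 2) ≤ C := by
  refine ⟨N.factorial * Real.exp (3 / 2), fun r hr => ?_⟩
  have h1 := Real.pow_div_factorial_le_exp (1 + r) (by positivity) N
  rw [div_le_iff₀ (by positivity)] at h1
  calc (1 + r) ^ N * Real.exp (-r ^ 2 / 2)
      ≤ (Real.exp (1 + r) * N.factorial) * Real.exp (3 / 2 - (1 + r)) := by
        gcongr
        -- The inequality `-r²/2 ≤ 3/2 - (1 + r)` is `(r - 1)² ≥ 0`; this is the source of the
        -- constant `3/2`.
        nlinarith [sq_nonneg (r - 1)]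
    _ = N.factorial * (Real.exp (1 + r) * Real.exp (3 / 2 - (1 + r))) := by ring
    _ = _ := by rw [← Real.exp_add]; congr 2; ring

end Gaussian

/-- The Gaussian `exp(-|x|²/2)` as a Schwartz function. -/
def gaussian (n : ℕ) : Sch n where
  toFun x := ((Real.exp (-‖x‖ ^ 2 / 2) : ℝ) : ℂ)
  smooth' := Complex.ofRealCLM.contDiff.comp (contDiff_gaussian.of_le le_top)
  decay' k l := by
    obtain ⟨C, m, hC, h⟩ := norm_iteratedFDeriv_gaussian_smul_le (E := EuclideanSpace ℝ (Fin n)) l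
      (Function.HasTemperateGrowth.const (1 : ℂ))
    obtain ⟨D, hD⟩ := pow_mul_exp_neg_sq_le (k + m)
    refine ⟨C * D, fun x => ?_⟩
    have e : (fun x : EuclideanSpace ℝ (Fin n) => ((Real.exp (-‖x‖ ^ 2 / 2) : ℝ) : ℂ)) =
        fun x => Real.exp (-‖x‖ ^ 2 / 2) • (1 : ℂ) := by ext x; simp
    rw [e]
    calc ‖x‖ ^ k * _ ≤ (1 + ‖x‖) ^ k * (C * (1 + ‖x‖) ^ m * Real.exp (-‖x‖ ^ 2 / 2)) := by
          gcongr
          · linarith [norm_nonneg x]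
          · exact h x
      _ = C * ((1 + ‖x‖) ^ (k + m) * Real.exp (-‖x‖ ^ 2 / 2)) := by ring
      _ ≤ C * D := by gcongr; exact hD _ (norm_nonneg x)

theorem gaussian_apply {n : ℕ} (x : EuclideanSpace ℝ (Fin n)) :
    gaussian n x = ((Real.exp (-‖x‖ ^ 2 / 2) : ℝ) : ℂ) := rfl

/-! ### Ladder operators -/

/-- The lowering operator `x_j + ∂/∂x_j`. -/
def lower {n : ℕ} (j : Fin n) : Module.End ℂ (Sch n) :=
  (mulX j + partialX j : Sch n →L[ℂ] Sch n).toLinearMap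

/-- The raising operator `x_j - ∂/∂x_j`. -/
def raise {n : ℕ} (j : Fin n) : Module.End ℂ (Sch n) :=
  (mulX j - partialX j : Sch n →L[ℂ] Sch n).toLinearMap

theorem lower_apply {n : ℕ} (j : Fin n) (f : Sch n) : lower j f = mulX j f + partialX j f := rfl

theorem raise_apply {n : ℕ} (j : Fin n) (f : Sch n) : raise j f = mulX j f - partialX j f := rfl

theorem mulX_eq {n : ℕ} (j : Fin n) (f : Sch n) :
    mulX j f = (1 / 2 : ℂ) • (lower j f + raise j f) := by
  rw [lower_apply, raise_apply]; module

theorem partialX_eq {n : ℕ} (j : Fin n) (f : Sch n) :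
    partialX j f = (1 / 2 : ℂ) • (lower j f - raise j f) := by
  rw [lower_apply, raise_apply]; module

theorem inner_raise {n : ℕ} (j : Fin n) (f g : Sch n) :
    inner ℂ (toL2 n (raise j f)) (toL2 n g) = inner ℂ (toL2 n f) (toL2 n (lower j g)) := by
  simp only [raise_apply, lower_apply, map_sub, map_add, inner_sub_left, inner_add_right,
    inner_mulX, inner_partialX, map_neg, inner_neg_right]
  ring

theorem inner_lower {n : ℕ} (j : Fin n) (f g : Sch n) :
    inner ℂ (toL2 n (lower j f)) (toL2 n g) = inner ℂ (toL2 n f) (toL2 n (raise j g)) := by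
  simp only [raise_apply, lower_apply, map_sub, map_add, inner_sub_right, inner_add_left,
    inner_mulX, inner_partialX, map_neg, inner_neg_right]
  ring

theorem mulX_comm {n : ℕ} (i j : Fin n) (f : Sch n) : mulX i (mulX j f) = mulX j (mulX i f) := by
  ext x; simp only [mulX_apply]; ring

theorem partialX_comm {n : ℕ} (i j : Fin n) (f : Sch n) :
    partialX i (partialX j f) = partialX j (partialX i f) := by
  ext x
  have hd (i j : Fin n) : partialX i (partialX j f) x =
      fderiv ℝ (fderiv ℝ f) x (EuclideanSpace.single i 1) (EuclideanSpace.single j 1) := by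
    have h1 : ∀ (g : Sch n) (k : Fin n), ⇑(partialX k g) =
        fun y => fderiv ℝ g y (EuclideanSpace.single k 1) := fun g k => by
      ext y
      exact SchwartzMap.lineDerivOp_apply_eq_fderiv _ g y
    rw [h1, h1]
    have h2 : DifferentiableAt ℝ (fderiv ℝ f) x :=
      ((f.smooth 2).fderiv_right (m := 1) (by norm_num)).differentiable (by simp) x
    have h3 := fderiv_clm_apply h2 (differentiableAt_const (EuclideanSpace.single j (1 : ℝ)))
    beta_reduce
    rw [h3]
    simp
  rw [hd, hd]
  have hs : IsSymmSndFDerivAt ℝ f x :=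
    (f.smooth 2).contDiffAt.isSymmSndFDerivAt (by simp [minSmoothness_of_isRCLikeNormedField])
  exact hs _ _

theorem partialX_mulX {n : ℕ} (i j : Fin n) (f : Sch n) :
    partialX i (mulX j f) = mulX j (partialX i f) + if i = j then f else 0 := by
  ext x
  have h1 : ∀ (g : Sch n), partialX i g x = fderiv ℝ g x (EuclideanSpace.single i 1) := fun g =>
    SchwartzMap.lineDerivOp_apply_eq_fderiv _ g x
  have h2 : ⇑(mulX j f) = fun y => Complex.ofRealCLM (EuclideanSpace.proj j y : ℝ) * f y := by
    ext y; rw [mulX_apply]; rfl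
  have h3 : HasFDerivAt (fun y : EuclideanSpace ℝ (Fin n) =>
      Complex.ofRealCLM (EuclideanSpace.proj j y : ℝ))
      (Complex.ofRealCLM.comp (EuclideanSpace.proj j : EuclideanSpace ℝ (Fin n) →L[ℝ] ℝ)) x :=
    (Complex.ofRealCLM.comp (EuclideanSpace.proj j : EuclideanSpace ℝ (Fin n) →L[ℝ] ℝ)).hasFDerivAt
  rw [h1, h2, (h3.fun_mul (f.hasFDerivAt x)).fderiv, add_apply, add_apply, mulX_apply, h1]
  by_cases h : i = j
  · subst h; simp
  · have h' : j ≠ i := fun e => h e.symm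
    simp [h, h']

theorem lower_gaussian {n : ℕ} (j : Fin n) : lower j (gaussian n) = 0 := by
  ext x
  have h1 : partialX j (gaussian n) x = fderiv ℝ (gaussian n) x (EuclideanSpace.single j 1) :=
    SchwartzMap.lineDerivOp_apply_eq_fderiv _ _ x
  have h2 : HasFDerivAt (gaussian n)
      (Complex.ofRealCLM.comp (-(Real.exp (-‖x‖ ^ 2 / 2)) • innerSL ℝ x)) x :=
    Complex.ofRealCLM.hasFDerivAt.comp x (hasFDerivAt_gaussian x)
  rw [lower_apply, add_apply, mulX_apply, h1, h2.fderiv]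
  simp [gaussian_apply, EuclideanSpace.inner_single_right]
  ring

theorem raise_comm {n : ℕ} (i j : Fin n) : raise i * raise j = raise j * raise (n := n) i := by
  refine LinearMap.ext fun f => ?_
  simp only [Module.End.mul_apply, raise_apply, map_sub, partialX_mulX, mulX_comm i j,
    partialX_comm i j]
  by_cases h : i = j
  · subst h; abel
  · have h' : j ≠ i := fun e => h e.symm
    simp only [h, h', if_false]; abel

/-- The canonical commutation relation. The ladder operators carry no factor `1/√2`, whence the `2`
here and in the formulas derived from it. -/
theorem lower_raise {n : ℕ} (i j : Fin n) (f : Sch n) :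
    lower i (raise j f) = raise j (lower i f) + if i = j then (2 : ℂ) • f else 0 := by
  simp only [lower_apply, raise_apply, map_sub, map_add, partialX_mulX, mulX_comm i j,
    partialX_comm i j]
  by_cases h : i = j
  · subst h; simp only [if_true]; module
  · have h' : j ≠ i := fun e => h e.symm
    simp only [h, h', if_false]; abel

/-! ### Hermite functions -/

/-- The substitution of the raising operators for the variables of a polynomial. -/
def raisePoly (n : ℕ) : MvPolynomial (Fin n) ℂ →ₐ[ℂ] Module.End ℂ (Sch n) :=
  -- `MvPolynomial.aeval` needs a commutative target, so evaluation takes place in the subalgebra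
  -- generated by the raising operators, which commute.
  letI : CommRing (Algebra.adjoin ℂ (Set.range (raise (n := n)))) :=
    { (Algebra.adjoin ℂ (Set.range (raise (n := n)))).toRing with
      mul_comm := (Algebra.isMulCommutative_adjoin ℂ (by
        rintro _ ⟨i, rfl⟩ _ ⟨j, rfl⟩; exact raise_comm i j)).is_comm.comm }
  (Algebra.adjoin ℂ (Set.range (raise (n := n)))).val.comp
    (MvPolynomial.aeval fun j => ⟨raise j, Algebra.subset_adjoin ⟨j, rfl⟩⟩)

theorem raisePoly_X {n : ℕ} (j : Fin n) : raisePoly n (MvPolynomial.X j) = raise j := by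
  simp only [raisePoly, AlgHom.comp_apply, MvPolynomial.aeval_X]
  rfl

/-- The map `p ↦ p(a†) exp(-|x|²/2)` from polynomials to Hermite functions. -/
def hermiteFun (n : ℕ) : MvPolynomial (Fin n) ℂ →ₗ[ℂ] Sch n :=
  (LinearMap.applyₗ (gaussian n)).comp (raisePoly n).toLinearMap

theorem hermiteFun_one (n : ℕ) : hermiteFun n 1 = gaussian n := by
  simp [hermiteFun]

theorem hermiteFun_C {n : ℕ} (c : ℂ) : hermiteFun n (MvPolynomial.C c) = c • gaussian n := by
  rw [← hermiteFun_one, ← map_smul, MvPolynomial.smul_eq_C_mul, mul_one]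

theorem hermiteFun_mul_X {n : ℕ} (p : MvPolynomial (Fin n) ℂ) (j : Fin n) :
    hermiteFun n (p * MvPolynomial.X j) = raise j (hermiteFun n p) := by
  rw [mul_comm]
  simp [hermiteFun, raisePoly_X]

/-- By the commutation relation `a_j` satisfies a Leibniz rule when moved past the `a_i†`, and it
annihilates the Gaussian at the end. -/
theorem lower_hermiteFun {n : ℕ} (j : Fin n) (p : MvPolynomial (Fin n) ℂ) :
    lower j (hermiteFun n p) = hermiteFun n ((2 : ℂ) • MvPolynomial.pderiv j p) := by
  induction p using MvPolynomial.induction_on with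
  | C c => simp [hermiteFun_C, lower_gaussian]
  | add p q hp hq => simp only [map_add, hp, hq, smul_add]
  | mul_X p i ih =>
    rw [hermiteFun_mul_X, lower_raise, ih, Derivation.leibniz, MvPolynomial.pderiv_X]
    by_cases h : j = i
    · subst h
      simp only [Pi.single_eq_same, smul_add, smul_eq_mul, map_add, if_true, mul_one, map_smul]
      rw [mul_comm, hermiteFun_mul_X]
      abel
    · simp only [Pi.single_eq_of_ne (Ne.symm h), smul_add, smul_eq_mul, map_add, if_neg h, mul_zero,
        map_smul, map_zero, smul_zero]
      rw [mul_comm, hermiteFun_mul_X, zero_add, add_zero]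

/-- Hermite functions as elements of `L²(ℝⁿ)`. -/
def hermiteL2 (n : ℕ) : MvPolynomial (Fin n) ℂ →ₗ[ℂ] L2 n :=
  (toL2 n).toLinearMap.comp (hermiteFun n)

theorem hermiteL2_apply {n : ℕ} (p : MvPolynomial (Fin n) ℂ) :
    hermiteL2 n p = toL2 n (hermiteFun n p) := rfl

theorem exists_hermiteFun_eq_mulX {n : ℕ} (p : MvPolynomial (Fin n) ℂ) (j : Fin n) :
    ∃ q, hermiteFun n q = mulX j (hermiteFun n p) :=
  ⟨(1 / 2 : ℂ) • ((2 : ℂ) • MvPolynomial.pderiv j p + p * MvPolynomial.X j), by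
    rw [mulX_eq, lower_hermiteFun, ← hermiteFun_mul_X, map_smul, map_add]⟩

/-- The adjunction between `X_j` and `2 ∂_j` allows inner products of Hermite functions to be
computed by induction on the polynomial. -/
theorem inner_hermiteL2_mul_X {n : ℕ} (p q : MvPolynomial (Fin n) ℂ) (j : Fin n) :
    inner ℂ (hermiteL2 n (p * MvPolynomial.X j)) (hermiteL2 n q) =
      inner ℂ (hermiteL2 n p) (hermiteL2 n ((2 : ℂ) • MvPolynomial.pderiv j q)) := by
  simp only [hermiteL2_apply, hermiteFun_mul_X, inner_raise, lower_hermiteFun]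

/-! ### The action of unitary matrices on polynomials -/

/-- The substitution `X_j ↦ ∑_k conj (g_kj) X_k`. -/
def polySubst {n : ℕ} (g : Matrix (Fin n) (Fin n) ℂ) :
    MvPolynomial (Fin n) ℂ →ₐ[ℂ] MvPolynomial (Fin n) ℂ :=
  MvPolynomial.aeval fun j => ∑ k, (starRingEnd ℂ) (g k j) • MvPolynomial.X k

theorem polySubst_X {n : ℕ} (g : Matrix (Fin n) (Fin n) ℂ) (j : Fin n) :
    polySubst g (MvPolynomial.X j) = ∑ k, (starRingEnd ℂ) (g k j) • MvPolynomial.X k := by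
  simp [polySubst]

theorem polySubst_C {n : ℕ} (g : Matrix (Fin n) (Fin n) ℂ) (c : ℂ) :
    polySubst g (MvPolynomial.C c) = MvPolynomial.C c :=
  MvPolynomial.aeval_C _ c

theorem polySubst_one {n : ℕ} : polySubst (1 : Matrix (Fin n) (Fin n) ℂ) = AlgHom.id ℂ _ := by
  refine MvPolynomial.algHom_ext fun j => ?_
  simp [polySubst_X, Matrix.one_apply]

theorem polySubst_mul {n : ℕ} (g h : Matrix (Fin n) (Fin n) ℂ) :
    polySubst (g * h) = (polySubst g).comp (polySubst h) := by
  refine MvPolynomial.algHom_ext fun j => ?_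
  simp only [AlgHom.comp_apply, polySubst_X, map_sum, map_smul, Matrix.mul_apply, map_mul,
    Finset.sum_smul, Finset.smul_sum, smul_smul]
  rw [Finset.sum_comm]
  exact Finset.sum_congr rfl fun _ _ => Finset.sum_congr rfl fun _ _ => by rw [mul_comm]

/-- The chain rule for a linear substitution. -/
theorem pderiv_polySubst {n : ℕ} (g : Matrix (Fin n) (Fin n) ℂ) (k : Fin n)
    (p : MvPolynomial (Fin n) ℂ) :
    MvPolynomial.pderiv k (polySubst g p) =
      ∑ j, (starRingEnd ℂ) (g k j) • polySubst g (MvPolynomial.pderiv j p) := by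
  induction p using MvPolynomial.induction_on with
  | C c => simp
  | add p q hp hq => simp only [map_add, hp, hq, smul_add, Finset.sum_add_distrib]
  | mul_X p i ih =>
    simp only [map_mul, Derivation.leibniz, ih, map_add, smul_eq_mul, smul_add,
      Finset.sum_add_distrib, MvPolynomial.pderiv_X]
    congr 1
    · simp [Pi.single_apply, apply_ite (polySubst g), polySubst_X, smul_ite, mul_ite,
        Finset.sum_ite_eq']
    · rw [Finset.mul_sum]
      exact Finset.sum_congr rfl fun j _ => by rw [mul_smul_comm]

theorem sum_mul_conj_unitary {n : ℕ} (g : Matrix.unitaryGroup (Fin n) ℂ) (i j : Fin n) :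
    ∑ k, (g : Matrix (Fin n) (Fin n) ℂ) k i * (starRingEnd ℂ) ((g : Matrix (Fin n) (Fin n) ℂ) k j) =
      if i = j then 1 else 0 := by
  have h := congrFun (congrFun (Matrix.UnitaryGroup.star_mul_self g) j) i
  rw [Matrix.mul_apply, Matrix.one_apply] at h
  simp only [eq_comm (a := i), ← h, Matrix.star_apply, mul_comm]
  rfl

/-- The Gaussian is orthogonal to every multiple of a variable, so both sides see only the constant
coefficient, which a linear substitution does not change. -/
theorem constantCoeff_polySubst {n : ℕ} (g : Matrix (Fin n) (Fin n) ℂ)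
    (p : MvPolynomial (Fin n) ℂ) :
    inner ℂ (hermiteL2 n 1) (hermiteL2 n (polySubst g p)) =
      inner ℂ (hermiteL2 n 1) (hermiteL2 n p) := by
  have h0 : ∀ (q : MvPolynomial (Fin n) ℂ) j,
      inner ℂ (hermiteL2 n 1) (hermiteL2 n (q * MvPolynomial.X j)) = 0 := fun q j => by
    rw [← inner_conj_symm, inner_hermiteL2_mul_X]; simp
  induction p using MvPolynomial.induction_on with
  | C c => rw [polySubst_C]
  | add p q hp hq => simp only [map_add, inner_add_right, hp, hq]
  | mul_X p i ih =>
    rw [h0, map_mul, polySubst_X, Finset.mul_sum, map_sum, inner_sum]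
    exact Finset.sum_eq_zero fun k _ => by
      rw [mul_smul_comm, map_smul, inner_smul_right, h0, mul_zero]

/-- The unitary group acts isometrically on Hermite functions. -/
theorem inner_polySubst {n : ℕ} (g : Matrix.unitaryGroup (Fin n) ℂ)
    (p q : MvPolynomial (Fin n) ℂ) :
    inner ℂ (hermiteL2 n (polySubst g p)) (hermiteL2 n (polySubst g q)) =
      inner ℂ (hermiteL2 n p) (hermiteL2 n q) := by
  induction p using MvPolynomial.induction_on generalizing q with
  | C c =>
    have : (MvPolynomial.C c : MvPolynomial (Fin n) ℂ) = c • 1 := by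
      rw [MvPolynomial.smul_eq_C_mul, mul_one]
    rw [polySubst_C, this, map_smul, inner_smul_left, inner_smul_left, constantCoeff_polySubst]
  | add p p' hp hp' => simp only [map_add, inner_add_left, hp, hp']
  | mul_X p i ih =>
    -- The linear form substituted for `X_i` crosses the inner product as a derivative. The chain
    -- rule then yields the coefficients `∑_k g_ki conj (g_kj)`, which unitarity reduces to `δ_ij`.
    rw [inner_hermiteL2_mul_X, ← ih, map_mul, polySubst_X, Finset.mul_sum, map_sum, sum_inner]
    simp only [mul_smul_comm, map_smul, inner_smul_left, inner_hermiteL2_mul_X, Complex.conj_conj,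
      pderiv_polySubst, map_sum, inner_sum, inner_smul_right, Finset.mul_sum]
    rw [Finset.sum_comm]
    have : ∀ j, ∑ k, (g : Matrix (Fin n) (Fin n) ℂ) k i * (2 * ((starRingEnd ℂ)
        ((g : Matrix (Fin n) (Fin n) ℂ) k j) * inner ℂ (hermiteL2 n (polySubst g p))
          (hermiteL2 n (polySubst g (MvPolynomial.pderiv j q))))) =
        (if i = j then 1 else 0) * (2 * inner ℂ (hermiteL2 n (polySubst g p))
          (hermiteL2 n (polySubst g (MvPolynomial.pderiv j q)))) := fun j => by
      rw [← sum_mul_conj_unitary g, Finset.sum_mul]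
      exact Finset.sum_congr rfl fun _ _ => by ring
    simp [this]

theorem polySubst_inv_apply {n : ℕ} (g : Matrix.unitaryGroup (Fin n) ℂ)
    (p : MvPolynomial (Fin n) ℂ) :
    polySubst (g⁻¹ : Matrix.unitaryGroup (Fin n) ℂ) (polySubst g p) = p := by
  rw [← AlgHom.comp_apply, ← polySubst_mul, ← Submonoid.coe_mul, inv_mul_cancel,
    Submonoid.coe_one, polySubst_one, AlgHom.id_apply]

/-- The action of a unitary matrix on polynomials as a linear equivalence. -/
def polySubstEquiv {n : ℕ} (g : Matrix.unitaryGroup (Fin n) ℂ) :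
    MvPolynomial (Fin n) ℂ ≃ₗ[ℂ] MvPolynomial (Fin n) ℂ :=
  LinearEquiv.ofLinearMap (polySubst (g : Matrix (Fin n) (Fin n) ℂ)).toLinearMap
    (polySubst ((g⁻¹ : Matrix.unitaryGroup (Fin n) ℂ) : Matrix (Fin n) (Fin n) ℂ)).toLinearMap
    (LinearMap.ext fun p => by
      have := polySubst_inv_apply g⁻¹ p
      rwa [inv_inv] at this)
    (LinearMap.ext fun p => polySubst_inv_apply g p)

theorem polySubstEquiv_apply {n : ℕ} (g : Matrix.unitaryGroup (Fin n) ℂ)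
    (p : MvPolynomial (Fin n) ℂ) : polySubstEquiv g p = polySubst g p := rfl

/-! ### Completeness of the Hermite functions -/

/-- The Gaussian absorbs the exponential and stays in `L²`, so Cauchy–Schwarz against `u` applies.
These exponential moments justify the termwise integration in `integral_exp_eq_zero_of_moments`. -/
theorem integrable_exp_mul_gaussian_mul {n : ℕ} {u : EuclideanSpace ℝ (Fin n) → ℂ}
    (hu : MemLp u 2) (c : ℝ) :
    Integrable fun x => Real.exp (c * ‖x‖) * ‖gaussian n x * u x‖ := by
  have h1 : MemLp (fun x : EuclideanSpace ℝ (Fin n) => Real.exp (c * ‖x‖ - ‖x‖ ^ 2 / 2)) 2 := by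
    rw [memLp_two_iff_integrable_sq (by fun_prop)]
    refine ((gaussian n).integrable.norm.const_mul (Real.exp (2 * c ^ 2))).mono' (by fun_prop) ?_
    refine Filter.Eventually.of_forall fun x => ?_
    rw [gaussian_apply, Complex.norm_real, Real.norm_of_nonneg (by positivity),
      Real.norm_of_nonneg (by positivity), ← Real.exp_add, ← Real.exp_nat_mul, Real.exp_le_exp]
    push_cast
    nlinarith [sq_nonneg (2 * c - ‖x‖)]
  refine (h1.integrable_mul hu.norm).congr (Filter.Eventually.of_forall fun x => ?_)
  simp only [Pi.mul_apply, gaussian_apply, norm_mul, Complex.norm_real,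
    Real.norm_of_nonneg (Real.exp_pos _).le]
  rw [← mul_assoc, ← Real.exp_add]
  ring_nf

/-- Expand the exponential and integrate termwise; the partial sums are dominated by `exp(‖z‖ ‖ξ‖
‖x‖) ‖w x‖`. The value `z = -2πi` turns vanishing moments into a vanishing Fourier transform. -/
theorem integral_exp_eq_zero_of_moments {n : ℕ} {w : EuclideanSpace ℝ (Fin n) → ℂ}
    (hm : AEStronglyMeasurable w)
    (hw : ∀ c : ℝ, Integrable fun x => Real.exp (c * ‖x‖) * ‖w x‖) (ξ : EuclideanSpace ℝ (Fin n))
    (h : ∀ k : ℕ, ∫ x, ((inner ℝ x ξ : ℝ) : ℂ) ^ k * w x = 0) (z : ℂ) :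
    ∫ x, Complex.exp (z * (inner ℝ x ξ : ℝ)) * w x = 0 := by
  have hb : ∀ x, HasSum (fun k : ℕ => (‖z‖ * |inner ℝ x ξ|) ^ k / k.factorial * ‖w x‖)
      (Real.exp (‖z‖ * |inner ℝ x ξ|) * ‖w x‖) := fun x => by
    have := NormedSpace.expSeries_div_hasSum_exp (𝔸 := ℝ) (‖z‖ * |inner ℝ x ξ|)
    rw [← Real.exp_eq_exp_ℝ] at this
    exact this.mul_right ‖w x‖
  have hf : ∀ x, HasSum (fun k : ℕ => (z * (inner ℝ x ξ : ℝ)) ^ k / k.factorial * w x)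
      (Complex.exp (z * (inner ℝ x ξ : ℝ)) * w x) := fun x => by
    have := NormedSpace.expSeries_div_hasSum_exp (𝔸 := ℂ) (z * (inner ℝ x ξ : ℝ))
    rw [← Complex.exp_eq_exp_ℂ] at this
    exact this.mul_right (w x)
  have h1 : ∀ k : ℕ, AEStronglyMeasurable
      (fun x => (z * (inner ℝ x ξ : ℝ)) ^ k / k.factorial * w x) := fun k => by
    refine AEStronglyMeasurable.mul (Continuous.aestronglyMeasurable ?_) hm
    exact ((continuous_const.mul (Complex.continuous_ofReal.comp
      (continuous_id.inner continuous_const))).pow k).div_const _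
  have h2 : Integrable fun x => ∑' k : ℕ, (‖z‖ * |inner ℝ x ξ|) ^ k / k.factorial * ‖w x‖ := by
    simp only [fun x => (hb x).tsum_eq]
    refine (hw (‖z‖ * ‖ξ‖)).mono' ((Continuous.aestronglyMeasurable ?_).mul hm.norm)
      (Filter.Eventually.of_forall fun x => ?_)
    · exact Real.continuous_exp.comp (continuous_const.mul
        (continuous_id.inner continuous_const).abs)
    rw [norm_mul, norm_norm, Real.norm_of_nonneg (Real.exp_pos _).le]
    refine mul_le_mul_of_nonneg_right (Real.exp_le_exp.2 ?_) (norm_nonneg _)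
    calc ‖z‖ * |inner ℝ x ξ| ≤ ‖z‖ * (‖x‖ * ‖ξ‖) := by gcongr; exact abs_real_inner_le_norm x ξ
      _ = ‖z‖ * ‖ξ‖ * ‖x‖ := by ring
  have h3 : ∀ (k : ℕ) x, ‖(z * (inner ℝ x ξ : ℝ)) ^ k / k.factorial * w x‖ ≤
      (‖z‖ * |inner ℝ x ξ|) ^ k / k.factorial * ‖w x‖ := fun k x => by
    rw [norm_mul, norm_div, norm_pow, norm_mul, Complex.norm_real, Real.norm_eq_abs,
      Complex.norm_natCast]
  have hs := hasSum_integral_of_dominated_convergence _ h1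
    (fun k => Filter.Eventually.of_forall (h3 k))
    (Filter.Eventually.of_forall fun x => (hb x).summable) h2 (Filter.Eventually.of_forall hf)
  refine hs.unique ?_
  have : ∀ k : ℕ, ∫ x, (z * (inner ℝ x ξ : ℝ)) ^ k / k.factorial * w x = 0 := fun k => by
    have e : ∀ x, (z * (inner ℝ x ξ : ℝ)) ^ k / k.factorial * w x =
        z ^ k / k.factorial * (((inner ℝ x ξ : ℝ) : ℂ) ^ k * w x) := fun x => by
      rw [mul_pow]; ring
    simp only [e]
    rw [integral_const_mul, h, mul_zero]
  simp only [this]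
  exact hasSum_zero

/-- Since `x_j = (a_j + a_j†)/2` preserves the Hermite functions, orthogonality to all of them gives
the vanishing of all moments against the Gaussian. -/
theorem exists_hermiteFun_eq_pow_mul {n : ℕ} (ξ : EuclideanSpace ℝ (Fin n)) (k : ℕ) :
    ∃ q, ∀ x, hermiteFun n q x = ((inner ℝ x ξ : ℝ) : ℂ) ^ k * gaussian n x := by
  induction k with
  | zero => exact ⟨1, fun x => by simp [hermiteFun_one]⟩
  | succ k ih =>
    obtain ⟨q, hq⟩ := ih
    choose r hr using exists_hermiteFun_eq_mulX q
    refine ⟨∑ j, (ξ j : ℂ) • r j, fun x => ?_⟩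
    have : ∀ s : Finset (Fin n), hermiteFun n (∑ j ∈ s, (ξ j : ℂ) • r j) x =
        (∑ j ∈ s, (ξ j : ℂ) * x j) * (((inner ℝ x ξ : ℝ) : ℂ) ^ k * gaussian n x) := fun s => by
      classical
      induction s using Finset.induction_on with
      | empty => simp
      | insert a s ha ih =>
        rw [Finset.sum_insert ha, Finset.sum_insert ha, map_add, add_apply, ih, map_smul,
          smul_apply, hr, mulX_apply, hq, smul_eq_mul]
        ring
    rw [this, pow_succ']
    have e : ((inner ℝ x ξ : ℝ) : ℂ) = ∑ j, (ξ j : ℂ) * x j := by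
      simp [PiLp.inner_apply]
    rw [e]
    ring

/-- Write a test function as the Fourier transform of its inverse transform and move that transform
onto `w`, where it vanishes. -/
theorem ae_eq_zero_of_fourier_eq_zero {n : ℕ} {w : EuclideanSpace ℝ (Fin n) → ℂ}
    (hw : Integrable w) (h : ∀ ξ, FourierTransform.fourier w ξ = 0) : w =ᵐ[volume] 0 := by
  refine ae_eq_zero_of_integral_contDiff_smul_eq_zero hw.locallyIntegrable fun g hg hgs => ?_
  let χ : Sch n := HasCompactSupport.toSchwartzMap (f := fun x => ((g x : ℝ) : ℂ))
    (hgs.comp_left (g := Complex.ofReal) Complex.ofReal_zero) (Complex.ofRealCLM.contDiff.comp hg)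
  have hflip := VectorFourier.integral_fourierIntegral_smul_eq_flip (F := ℂ)
    (μ := (volume : Measure (EuclideanSpace ℝ (Fin n))))
    (ν := (volume : Measure (EuclideanSpace ℝ (Fin n)))) (L := innerₗ (EuclideanSpace ℝ (Fin n)))
    Real.continuous_fourierChar
    continuous_inner hw (FourierTransformInv.fourierInv χ).integrable
  have h1 : ∀ x, VectorFourier.fourierIntegral Real.fourierChar volume
      (innerₗ (EuclideanSpace ℝ (Fin n))).flip (⇑(FourierTransformInv.fourierInv χ)) x = g x :=
    fun x => by
    rw [flip_innerₗ]
    change (FourierTransform.fourier (⇑(FourierTransformInv.fourierInv χ) :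
      EuclideanSpace ℝ (Fin n) → ℂ)) x = _
    rw [← SchwartzMap.fourier_coe, FourierTransform.fourier_fourierInv_eq]
    rfl
  have h2 : ∀ ξ, VectorFourier.fourierIntegral Real.fourierChar volume
      (innerₗ (EuclideanSpace ℝ (Fin n))) w ξ = 0 := h
  simp only [h1, h2, zero_smul, integral_zero] at hflip
  rw [hflip]
  exact integral_congr_ae (Filter.Eventually.of_forall fun x => by simp [mul_comm])

/-- The Hermite functions span a dense subspace. -/
theorem eq_zero_of_inner_hermiteL2 {n : ℕ} (u : L2 n)
    (h : ∀ p, inner ℂ (hermiteL2 n p) u = 0) : u = 0 := by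
  have hu : MemLp u 2 := Lp.memLp u
  have hw : Integrable fun x => gaussian n x * u x := by
    have := integrable_exp_mul_gaussian_mul hu 0
    simp only [zero_mul, Real.exp_zero, one_mul] at this
    exact (integrable_norm_iff ((gaussian n).continuous.aestronglyMeasurable.mul hu.1)).1 this
  have hmom : ∀ ξ (k : ℕ), ∫ x, ((inner ℝ x ξ : ℝ) : ℂ) ^ k * (gaussian n x * u x) = 0 :=
    fun ξ k => by
    obtain ⟨q, hq⟩ := exists_hermiteFun_eq_pow_mul ξ k
    rw [← h q, MeasureTheory.L2.inner_def]
    refine integral_congr_ae ?_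
    filter_upwards [(hermiteFun n q).coeFn_toLp 2 volume] with x hx
    have hx' : (hermiteL2 n q : EuclideanSpace ℝ (Fin n) → ℂ) x = hermiteFun n q x := hx
    rw [hx', hq]
    simp only [RCLike.inner_apply, map_mul, map_pow, gaussian_apply, Complex.conj_ofReal]
    ring
  have hF : ∀ ξ, FourierTransform.fourier (fun x => gaussian n x * u x) ξ = 0 := fun ξ => by
    rw [Real.fourier_eq']
    rw [← integral_exp_eq_zero_of_moments
      ((gaussian n).continuous.aestronglyMeasurable.mul hu.1) (integrable_exp_mul_gaussian_mul hu) ξ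
        (hmom ξ) (-2 * Real.pi * Complex.I)]
    congr 1
    ext x
    rw [smul_eq_mul]
    congr 2
    push_cast
    ring
  have h0 := ae_eq_zero_of_fourier_eq_zero hw hF
  rw [Lp.eq_zero_iff_ae_eq_zero]
  filter_upwards [h0] with x hx
  have : gaussian n x ≠ 0 := by
    rw [gaussian_apply]; exact_mod_cast (Real.exp_pos _).ne'
  simpa [this] using hx

theorem ext_inner_hermiteL2 {n : ℕ} {u v : L2 n}
    (h : ∀ p, inner ℂ (hermiteL2 n p) u = inner ℂ (hermiteL2 n p) v) : u = v :=
  sub_eq_zero.1 (eq_zero_of_inner_hermiteL2 _ fun p => by rw [inner_sub_right, h, sub_self])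

theorem denseRange_hermiteL2 (n : ℕ) : DenseRange (hermiteL2 n) := by
  have : (LinearMap.range (hermiteL2 n)).topologicalClosure = ⊤ := by
    rw [Submodule.topologicalClosure_eq_top_iff, Submodule.eq_bot_iff]
    intro u hu
    exact eq_zero_of_inner_hermiteL2 u fun p =>
      (Submodule.mem_orthogonal _ _).1 hu _ (LinearMap.mem_range_self _ p)
  exact (Submodule.dense_iff_topologicalClosure_eq_top).2 this

/-! ### The metaplectic representation -/

/-- The unitary operator given on Hermite functions by the substitution `polySubst g`. -/
def metaOp {n : ℕ} (g : Matrix.unitaryGroup (Fin n) ℂ) : L2 n ≃ₗᵢ[ℂ] L2 n :=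
  (polySubstEquiv g).extendOfIsometry (hermiteL2 n) (hermiteL2 n) (denseRange_hermiteL2 n)
    (denseRange_hermiteL2 n) fun p => by
      rw [@norm_eq_sqrt_re_inner ℂ, @norm_eq_sqrt_re_inner ℂ, polySubstEquiv_apply,
        inner_polySubst]

theorem metaOp_hermiteL2 {n : ℕ} (g : Matrix.unitaryGroup (Fin n) ℂ)
    (p : MvPolynomial (Fin n) ℂ) : metaOp g (hermiteL2 n p) = hermiteL2 n (polySubst g p) :=
  LinearEquiv.extendOfIsometry_eq _ _ _ (denseRange_hermiteL2 n) (denseRange_hermiteL2 n) _ p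

/-- The metaplectic representation. -/
def metaRep (n : ℕ) : Matrix.unitaryGroup (Fin n) ℂ →* (L2 n ≃ₗᵢ[ℂ] L2 n) :=
  MonoidHom.mk' metaOp fun g h => by
    refine LinearIsometryEquiv.ext fun u => ?_
    refine congrFun ((denseRange_hermiteL2 n).equalizer (metaOp (g * h)).continuous
      ((metaOp g).continuous.comp (metaOp h).continuous) (funext fun p => ?_)) u
    simp only [Function.comp_apply, metaOp_hermiteL2, Submonoid.coe_mul, polySubst_mul,
      AlgHom.comp_apply]

theorem metaRep_hermiteL2 {n : ℕ} (g : Matrix.unitaryGroup (Fin n) ℂ)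
    (p : MvPolynomial (Fin n) ℂ) :
    metaRep n g (hermiteL2 n p) = hermiteL2 n (polySubst g p) :=
  metaOp_hermiteL2 g p

theorem inner_metaRep_right {n : ℕ} (g : Matrix.unitaryGroup (Fin n) ℂ) (u v : L2 n) :
    inner ℂ u (metaRep n g v) = inner ℂ (metaRep n g⁻¹ u) v := by
  have : metaRep n g (metaRep n g⁻¹ u) = u := by
    change (metaRep n g * metaRep n g⁻¹) u = u
    rw [← map_mul, mul_inv_cancel, map_one]
    rfl
  rw [← (metaRep n g).inner_map_map (metaRep n g⁻¹ u) v, this]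

/-! ### The Weyl quantization in terms of ladder operators -/

theorem weylQuadratic_apply {n : ℕ} (M : Matrix (Fin n ⊕ Fin n) (Fin n ⊕ Fin n) ℝ) (f : Sch n) :
    weylQuadratic M f = (1 / 2 : ℂ) • ∑ a, ∑ b, (M a b : ℂ) •
      ((1 / 2 : ℂ) • (canonicalOp a (canonicalOp b f) + canonicalOp b (canonicalOp a f))) := by
  simp [weylQuadratic]

/-- The block form makes the `a a` and `a† a†` terms cancel for each pair of indices. Normal
ordering of `a a†` leaves the constant `tr A / 2`, and the symmetries of `A` and `B` merge the two
remaining sums of `a† a`. -/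
theorem weylQuadratic_eq_ladder {n : ℕ} {A B : Matrix (Fin n) (Fin n) ℝ} (hA : Aᵀ = A)
    (hB : Bᵀ = -B) (f : Sch n) :
    weylQuadratic (Matrix.fromBlocks A (-B) B A) f =
      ((A.trace : ℂ) / 2) • f + (Complex.I / 2) • ∑ k, ∑ j,
        ((B k j : ℂ) - Complex.I * A k j) • raise k (lower j f) := by
  have hx : ∀ (j : Fin n) (f : Sch n), canonicalOp (Sum.inl j) f =
      (1 / 2 : ℂ) • (lower j f + raise j f) := fun j f => mulX_eq j f
  have hp : ∀ (j : Fin n) (f : Sch n), canonicalOp (Sum.inr j) f =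
      (-Complex.I / 2) • (lower j f - raise j f) := fun j f => by
    change (-Complex.I) • partialX j f = _
    rw [partialX_eq]; module
  have hlr : ∀ (i j : Fin n), lower i (raise j f) =
      raise j (lower i f) + (if i = j then (2 : ℂ) else 0) • f := fun i j => by
    rw [lower_raise]; split_ifs <;> simp
  have hI : Complex.I * Complex.I = -1 := Complex.I_mul_I
  have key : ∀ i j : Fin n,
      ((A i j : ℝ) : ℂ) • ((1 / 2 : ℂ) • (canonicalOp (Sum.inl i) (canonicalOp (Sum.inl j) f) +
        canonicalOp (Sum.inl j) (canonicalOp (Sum.inl i) f))) +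
      ((-B i j : ℝ) : ℂ) • ((1 / 2 : ℂ) • (canonicalOp (Sum.inl i) (canonicalOp (Sum.inr j) f) +
        canonicalOp (Sum.inr j) (canonicalOp (Sum.inl i) f))) +
      (((B i j : ℝ) : ℂ) • ((1 / 2 : ℂ) • (canonicalOp (Sum.inr i) (canonicalOp (Sum.inl j) f) +
        canonicalOp (Sum.inl j) (canonicalOp (Sum.inr i) f))) +
      ((A i j : ℝ) : ℂ) • ((1 / 2 : ℂ) • (canonicalOp (Sum.inr i) (canonicalOp (Sum.inr j) f) +
        canonicalOp (Sum.inr j) (canonicalOp (Sum.inr i) f)))) =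
      ((A i j : ℂ) * if i = j then 1 else 0) • f +
        (((A i j : ℂ) / 2 + (Complex.I / 2) * B i j) • raise i (lower j f) +
         ((A i j : ℂ) / 2 - (Complex.I / 2) * B i j) • raise j (lower i f)) := fun i j => by
    have hδ : (if i = j then (1 : ℂ) else 0) = (1 / 2) * (if i = j then (2 : ℂ) else 0) := by
      split_ifs <;> norm_num
    have hδ' : (if j = i then (2 : ℂ) else 0) = (if i = j then (2 : ℂ) else 0) := by
      simp only [eq_comm]
    simp only [hx, hp, map_add, map_sub, map_smul, hlr, hδ, hδ', Complex.ofReal_neg]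
    generalize (if i = j then (2 : ℂ) else 0) = δ
    match_scalars <;> first | ring1 | (ring_nf; rw [Complex.I_sq]; ring1)
  rw [weylQuadratic_apply]
  simp only [Fintype.sum_sum_type, Matrix.fromBlocks_apply₁₁, Matrix.fromBlocks_apply₁₂,
    Matrix.fromBlocks_apply₂₁, Matrix.fromBlocks_apply₂₂, Matrix.neg_apply, ← Finset.sum_add_distrib,
    key]
  have hA' : ∀ i j, A i j = A j i := fun i j => congrFun (congrFun hA j) i
  have hB' : ∀ i j, B i j = -B j i := fun i j => congrFun (congrFun hB j) i
  have hsw : ∑ i, ∑ j, ((A i j : ℂ) / 2 - (Complex.I / 2) * B i j) • raise j (lower i f) =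
      ∑ i, ∑ j, ((A i j : ℂ) / 2 + (Complex.I / 2) * B i j) • raise i (lower j f) := by
    rw [Finset.sum_comm]
    refine Finset.sum_congr rfl fun i _ => Finset.sum_congr rfl fun j _ => ?_
    rw [hA' j i, hB' j i]
    push_cast
    congr 1
    ring
  have htr : ∑ i, ∑ j, ((A i j : ℂ) * if i = j then 1 else 0) • f = (A.trace : ℂ) • f := by
    simp [Matrix.trace, Finset.sum_smul]
  simp only [Finset.sum_add_distrib, hsw, htr]
  rw [smul_add, smul_smul, ← two_smul ℂ, smul_smul, Finset.smul_sum, Finset.smul_sum]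
  congr 1
  · congr 1; ring
  · refine Finset.sum_congr rfl fun k _ => ?_
    rw [Finset.smul_sum, Finset.smul_sum]
    refine Finset.sum_congr rfl fun j _ => ?_
    rw [smul_smul, smul_smul]
    congr 1
    linear_combination ((A k j : ℂ) / 2) * hI

/-! ### Schrödinger groups that preserve the Hermite functions -/

section Groups

variable {n : ℕ} {H : Sch n →L[ℂ] Sch n} {U V : ℝ → (L2 n ≃ₗᵢ[ℂ] L2 n)}

/-- From `U s = U t U (s - t)`: only the derivative at `0` on `u` itself is needed. -/
theorem hasDerivAt_group_left (hadd : ∀ s t : ℝ, U (s + t) = U s * U t) {u w : L2 n}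
    (h : HasDerivAt (fun t => U t u) w 0) (t : ℝ) :
    HasDerivAt (fun t => U t u) (U t w) t := by
  have h1 : HasDerivAt (fun s : ℝ => U (s - t) u) w t := by
    have h' : HasDerivAt (fun t => U t u) w (t - t) := by rwa [sub_self]
    exact h'.comp_sub_const t t
  have h2 := ((U t).toContinuousLinearEquiv.toContinuousLinearMap.restrictScalars
    ℝ).hasFDerivAt.comp_hasDerivAt t h1
  refine h2.congr_of_eventuallyEq (Filter.Eventually.of_forall fun s => ?_)
  change U s u = (U t * U (s - t)) u
  rw [← hadd]
  congr 2
  ring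

/-- From `U s = U (s - t) U t`. It applies when `U t u` is again a vector on which the generator is
known, such as a Hermite function. -/
theorem hasDerivAt_group_right (hadd : ∀ s t : ℝ, U (s + t) = U s * U t) {u w : L2 n} (t : ℝ)
    (h : HasDerivAt (fun s => U s (U t u)) w 0) :
    HasDerivAt (fun t => U t u) w t := by
  have h' : HasDerivAt (fun s => U s (U t u)) w (t - t) := by rwa [sub_self]
  refine (h'.comp_sub_const t t).congr_of_eventuallyEq (Filter.Eventually.of_forall fun s => ?_)
  change U s u = (U (s - t) * U t) u
  rw [← hadd]
  congr 2
  ring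

theorem inner_group (h0 : U 0 = 1) (hadd : ∀ s t : ℝ, U (s + t) = U s * U t) (t : ℝ) (u v : L2 n) :
    inner ℂ u (U t v) = inner ℂ (U (-t) u) v := by
  have : U t (U (-t) u) = u := by
    change (U t * U (-t)) u = u
    rw [← hadd, add_neg_cancel, h0]
    rfl
  rw [← (U t).inner_map_map (U (-t) u) v, this]

theorem continuous_of_dense {s : Set (L2 n)} (hs : Dense s)
    (h : ∀ u ∈ s, Continuous fun t => U t u) (u : L2 n) : Continuous fun t => U t u := by
  refine continuous_of_uniform_approx_of_continuous fun W hW => ?_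
  obtain ⟨ε, hε, hW⟩ := Metric.mem_uniformity_dist.1 hW
  obtain ⟨v, hv, huv⟩ := Metric.dense_iff.1 hs u ε hε
  refine ⟨fun t => U t v, h v huv, fun t => hW ?_⟩
  rw [(U t).dist_map, dist_comm]
  exact hv

theorem inner_smul_skew
    (hH : ∀ f g, inner ℂ (toL2 n (H f)) (toL2 n g) = inner ℂ (toL2 n f) (toL2 n (H g)))
    (f g : Sch n) :
    inner ℂ ((-Complex.I) • toL2 n (H f)) (toL2 n g) =
      -inner ℂ (toL2 n f) ((-Complex.I) • toL2 n (H g)) := by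
  rw [inner_smul_left, inner_smul_right, hH]
  simp

/-- Knowledge of the generator on an invariant dense space of Hermite functions extends to all
Schwartz functions. The integral equation `U_t f = f + ∫₀ᵗ U_s (-iHf) ds` is tested against a
Hermite function `p`: `⟨p, U_t f⟩ = ⟨U_{-t} p, f⟩` can be differentiated because `U_{-t} p` is a
Hermite function, and symmetry moves `H` to `f`. The right side of the equation is differentiable at
`0`. -/
theorem isSchrodingerGroup_of_hermiteL2
    (hH : ∀ f g, inner ℂ (toL2 n (H f)) (toL2 n g) = inner ℂ (toL2 n f) (toL2 n (H g)))
    (h0 : U 0 = 1) (hadd : ∀ s t : ℝ, U (s + t) = U s * U t)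
    (hinv : ∀ t p, ∃ q, U t (hermiteL2 n p) = hermiteL2 n q)
    (hder : ∀ p, HasDerivAt (fun t : ℝ => U t (hermiteL2 n p))
      ((-Complex.I) • toL2 n (H (hermiteFun n p))) 0) : IsSchrodingerGroup H U := by
  have hcont : ∀ u : L2 n, Continuous fun t => U t u :=
    continuous_of_dense (denseRange_hermiteL2 n) (by
      rintro _ ⟨p, rfl⟩
      exact continuous_iff_continuousAt.2 fun t =>
        (hasDerivAt_group_left hadd (hder p) t).continuousAt)
  refine ⟨h0, hadd, hcont, fun f => ?_⟩
  set w : L2 n := (-Complex.I) • toL2 n (H f) with hw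
  have hW : ∀ t : ℝ, HasDerivAt (fun t : ℝ => ∫ s in (0 : ℝ)..t, U s w) (U t w) t := fun t =>
    intervalIntegral.integral_hasDerivAt_right ((hcont w).intervalIntegrable _ _)
      ((hcont w).stronglyMeasurableAtFilter _ _) (hcont w).continuousAt
  have key : ∀ t : ℝ, U t (toL2 n f) = toL2 n f + ∫ s in (0 : ℝ)..t, U s w := fun t => by
    refine ext_inner_hermiteL2 fun p => ?_
    have hd : ∀ t : ℝ, HasDerivAt (fun t : ℝ => inner ℂ (hermiteL2 n p) (U t (toL2 n f)) -
        inner ℂ (hermiteL2 n p) (toL2 n f + ∫ s in (0 : ℝ)..t, U s w)) 0 t := fun t => by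
      obtain ⟨q, hq⟩ := hinv (-t) p
      have h1 : HasDerivAt (fun t => U t (hermiteL2 n p))
          ((-Complex.I) • toL2 n (H (hermiteFun n q))) (-t) :=
        hasDerivAt_group_right hadd (-t) (by rw [hq]; exact hder q)
      have h2 := h1.scomp t (hasDerivAt_neg t)
      have h3 := (h2.inner ℂ (hasDerivAt_const t (toL2 n f))).sub
        ((hasDerivAt_const t (hermiteL2 n p)).inner ℂ ((hW t).const_add (toL2 n f)))
      refine (h3.congr_deriv ?_).congr_of_eventuallyEq (Filter.Eventually.of_forall fun s => ?_)
      · rw [neg_one_smul ℝ, inner_neg_left, inner_smul_skew hH, neg_neg,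
          inner_group h0 hadd t, hq, hermiteL2_apply q, inner_zero_right, inner_zero_left, zero_add,
          add_zero, sub_self]
      · simp only [Pi.sub_apply, Function.comp_apply]
        rw [inner_group h0 hadd]
    have hc := is_const_of_deriv_eq_zero (fun t => (hd t).differentiableAt) (fun t => (hd t).deriv) t 0
    rw [h0, intervalIntegral.integral_same, add_zero, LinearIsometryEquiv.coe_one, id_eq, sub_self] at hc
    exact sub_eq_zero.1 hc
  have h1 := (hW 0).const_add (toL2 n f)
  rw [h0] at h1
  exact h1.congr_of_eventuallyEq (Filter.Eventually.of_forall key)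

/-- The function `t ↦ ⟨U_t p, V_t q⟩` is constant for Hermite functions `p` and `q`, so `V_{-t} U_t`
is the identity on a dense subspace. Invariance is needed for `V` alone. -/
theorem IsSchrodingerGroup.eq_of_hermiteL2
    (hU : IsSchrodingerGroup H U) (hV : IsSchrodingerGroup H V)
    (hinv : ∀ t p, ∃ q, V t (hermiteL2 n p) = hermiteL2 n q) (t : ℝ) : U t = V t := by
  -- `U_t f` is not known to be Schwartz, so `H` cannot be applied to it. Differentiating `⟨U_t f,
  -- g⟩ = ⟨f, U_{-t} g⟩` on both sides gives the skew-symmetry of the generator in weak form.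
  have hweak : ∀ (t : ℝ) (f g : Sch n),
      inner ℂ (U t ((-Complex.I) • toL2 n (H f))) (toL2 n g) =
        -inner ℂ (U t (toL2 n f)) ((-Complex.I) • toL2 n (H g)) := fun t f g => by
    have h1 := (hasDerivAt_group_left hU.map_add (hU.hasDerivAt f) t).inner ℂ
      (hasDerivAt_const t (toL2 n g))
    have h2 := (hasDerivAt_const t (toL2 n f)).inner ℂ
      ((hasDerivAt_group_left hU.map_add (hU.hasDerivAt g) (-t)).scomp t (hasDerivAt_neg t))
    have e : (fun t => inner ℂ (toL2 n f) (((fun t => U t (toL2 n g)) ∘ Neg.neg) t)) =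
        fun t => inner ℂ (U t (toL2 n f)) (toL2 n g) := funext fun s => by
      rw [Function.comp_apply, inner_group hU.map_zero hU.map_add, neg_neg]
    rw [e] at h2
    have h3 := h1.unique h2
    rw [inner_zero_right, zero_add, inner_zero_left, add_zero, neg_one_smul ℝ, inner_neg_right,
      inner_group hU.map_zero hU.map_add, neg_neg] at h3
    exact h3
  have hd : ∀ p q (t : ℝ), HasDerivAt
      (fun t => inner ℂ (U t (hermiteL2 n p)) (V t (hermiteL2 n q))) 0 t := fun p q t => by
    obtain ⟨r, hr⟩ := hinv t q
    have h2 : HasDerivAt (fun t => V t (hermiteL2 n q))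
        ((-Complex.I) • toL2 n (H (hermiteFun n r))) t :=
      hasDerivAt_group_right hV.map_add t (by rw [hr]; exact hV.hasDerivAt _)
    refine ((hasDerivAt_group_left hU.map_add (hU.hasDerivAt (hermiteFun n p)) t).inner ℂ
      h2).congr_deriv ?_
    rw [hr, hermiteL2_apply r, hweak, add_neg_cancel]
  refine LinearIsometryEquiv.ext fun u => ?_
  refine congrFun ((denseRange_hermiteL2 n).equalizer (U t).continuous (V t).continuous
    (funext fun p => ?_)) u
  have h1 : V (-t) (U t (hermiteL2 n p)) = hermiteL2 n p := by
    refine ext_inner_hermiteL2 fun q => ?_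
    have hc := is_const_of_deriv_eq_zero (fun t => (hd p q t).differentiableAt)
      (fun t => (hd p q t).deriv) t 0
    simp only [hU.map_zero, hV.map_zero, LinearIsometryEquiv.coe_one, id_eq] at hc
    rw [inner_group hV.map_zero hV.map_add, neg_neg, ← inner_conj_symm, hc, inner_conj_symm]
  change U t (hermiteL2 n p) = V t (hermiteL2 n p)
  conv_rhs => rw [← h1]
  change _ = (V t * V (-t)) (U t (hermiteL2 n p))
  rw [← hV.map_add, add_neg_cancel, hV.map_zero]
  rfl

end Groups

/-! ### Exponentials in the unitary group -/

/-- The complex matrix `B + iA`. -/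
def cplxMat {n : ℕ} (A B : Matrix (Fin n) (Fin n) ℝ) : Matrix (Fin n) (Fin n) ℂ :=
  B.map Complex.ofReal + Complex.I • A.map Complex.ofReal

theorem cplxMat_apply {n : ℕ} (A B : Matrix (Fin n) (Fin n) ℝ) (i j : Fin n) :
    cplxMat A B i j = B i j + Complex.I * A i j := rfl

theorem cplxMat_mem_skewAdjoint {n : ℕ} {A B : Matrix (Fin n) (Fin n) ℝ} (hA : Aᵀ = A)
    (hB : Bᵀ = -B) : cplxMat A B ∈ skewAdjoint (Matrix (Fin n) (Fin n) ℂ) := by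
  rw [skewAdjoint.mem_iff]
  ext i j
  have h1 : A j i = A i j := congrFun (congrFun hA i) j
  have h2 : B j i = -B i j := congrFun (congrFun hB i) j
  simp only [Matrix.star_apply, Matrix.neg_apply, cplxMat_apply, h1, h2]
  simp
  ring

section Exp

attribute [local instance] Matrix.linftyOpNormedRing Matrix.linftyOpNormedAlgebra

theorem exp_mem_unitaryGroup {n : ℕ} {Z : Matrix (Fin n) (Fin n) ℂ}
    (hZ : Z ∈ skewAdjoint (Matrix (Fin n) (Fin n) ℂ)) :
    NormedSpace.exp Z ∈ Matrix.unitaryGroup (Fin n) ℂ := by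
  have h : Zᴴ = -Z := skewAdjoint.mem_iff.1 hZ
  rw [Matrix.mem_unitaryGroup_iff, Matrix.star_eq_conjTranspose, ← Matrix.exp_conjTranspose, h,
    ← Matrix.exp_add_of_commute _ _ (Commute.refl Z).neg_right, add_neg_cancel,
    NormedSpace.exp_zero]

theorem hasDerivAt_exp_smul_apply {n : ℕ} (Z : Matrix (Fin n) (Fin n) ℂ) (i j : Fin n) :
    HasDerivAt (fun t : ℝ => NormedSpace.exp (t • Z) i j) (Z i j) 0 := by
  have h := hasDerivAt_exp_smul_const (𝕂 := ℝ) Z 0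
  rw [zero_smul, NormedSpace.exp_zero, one_mul] at h
  exact hasDerivAt_pi.1 (hasDerivAt_pi.1 h i) j

end Exp

/-- The one-parameter group `t ↦ exp (t Z)` in the unitary group. -/
def expUnitary {n : ℕ} {Z : Matrix (Fin n) (Fin n) ℂ}
    (hZ : Z ∈ skewAdjoint (Matrix (Fin n) (Fin n) ℂ)) (t : ℝ) : Matrix.unitaryGroup (Fin n) ℂ :=
  ⟨NormedSpace.exp (t • Z), exp_mem_unitaryGroup (skewAdjoint.smul_mem t hZ)⟩

theorem expUnitary_coe {n : ℕ} {Z : Matrix (Fin n) (Fin n) ℂ}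
    (hZ : Z ∈ skewAdjoint (Matrix (Fin n) (Fin n) ℂ)) (t : ℝ) :
    (expUnitary hZ t : Matrix (Fin n) (Fin n) ℂ) = NormedSpace.exp (t • Z) := rfl

theorem expUnitary_zero {n : ℕ} {Z : Matrix (Fin n) (Fin n) ℂ}
    (hZ : Z ∈ skewAdjoint (Matrix (Fin n) (Fin n) ℂ)) : expUnitary hZ 0 = 1 := by
  ext1
  rw [expUnitary_coe, zero_smul, NormedSpace.exp_zero]
  rfl

theorem expUnitary_add {n : ℕ} {Z : Matrix (Fin n) (Fin n) ℂ}
    (hZ : Z ∈ skewAdjoint (Matrix (Fin n) (Fin n) ℂ)) (s t : ℝ) :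
    expUnitary hZ (s + t) = expUnitary hZ s * expUnitary hZ t := by
  ext1
  rw [Submonoid.coe_mul]
  simp only [expUnitary_coe]
  rw [add_smul, Matrix.exp_add_of_commute _ _ (((Commute.refl Z).smul_left s).smul_right t)]

/-- The derivation of polynomials that generates `polySubst (exp (t Z))`. -/
def polyGen {n : ℕ} (Z : Matrix (Fin n) (Fin n) ℂ) (p : MvPolynomial (Fin n) ℂ) :
    MvPolynomial (Fin n) ℂ :=
  ∑ k, ∑ j, (starRingEnd ℂ) (Z k j) • (MvPolynomial.pderiv j p * MvPolynomial.X k)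

theorem polyGen_C {n : ℕ} (Z : Matrix (Fin n) (Fin n) ℂ) (c : ℂ) :
    polyGen Z (MvPolynomial.C c) = 0 := by
  simp [polyGen]

theorem polyGen_add {n : ℕ} (Z : Matrix (Fin n) (Fin n) ℂ) (p q : MvPolynomial (Fin n) ℂ) :
    polyGen Z (p + q) = polyGen Z p + polyGen Z q := by
  simp [polyGen, add_mul, Finset.sum_add_distrib]

theorem polyGen_mul_X {n : ℕ} (Z : Matrix (Fin n) (Fin n) ℂ) (p : MvPolynomial (Fin n) ℂ)
    (i : Fin n) :
    polyGen Z (p * MvPolynomial.X i) =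
      polyGen Z p * MvPolynomial.X i +
        ∑ k, (starRingEnd ℂ) (Z k i) • (p * MvPolynomial.X k) := by
  simp only [polyGen, Derivation.leibniz, MvPolynomial.pderiv_X, smul_eq_mul, add_mul, smul_add,
    Finset.sum_add_distrib, Finset.sum_mul]
  rw [add_comm]
  congr 1
  · refine Finset.sum_congr rfl fun k _ => Finset.sum_congr rfl fun j _ => ?_
    rw [smul_mul_assoc]
    congr 1
    ring
  · refine Finset.sum_congr rfl fun k _ => ?_
    simp [Pi.single_apply, mul_ite, ite_mul, smul_ite]

/-- The derivative is taken after a linear map `L` into a normed space, so no topology on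
polynomials is needed. Since `L` is arbitrary, the induction can absorb multiplication by `X_k` into
it. -/
theorem hasDerivAt_polySubst {n : ℕ} {E : Type*} [NormedAddCommGroup E] [NormedSpace ℂ E]
    {g : ℝ → Matrix (Fin n) (Fin n) ℂ} {Z : Matrix (Fin n) (Fin n) ℂ} (h0 : g 0 = 1)
    (hg : ∀ i j, HasDerivAt (fun t => g t i j) (Z i j) 0) (p : MvPolynomial (Fin n) ℂ)
    (L : MvPolynomial (Fin n) ℂ →ₗ[ℂ] E) :
    HasDerivAt (fun t : ℝ => L (polySubst (g t) p)) (L (polyGen Z p)) 0 := by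
  induction p using MvPolynomial.induction_on generalizing L with
  | C c => simpa only [polySubst_C, polyGen_C, map_zero] using hasDerivAt_const (0 : ℝ) _
  | add p q hp hq => simpa only [map_add, polyGen_add] using (hp L).fun_add (hq L)
  | mul_X p i ih =>
    have hconj : ∀ k, HasDerivAt (fun t => (starRingEnd ℂ) (g t k i)) ((starRingEnd ℂ) (Z k i)) 0 :=
      fun k => Complex.conjCLE.toContinuousLinearMap.hasFDerivAt.comp_hasDerivAt 0 (hg k i)
    have hk : ∀ k, HasDerivAt
        (fun t => (starRingEnd ℂ) (g t k i) • L (polySubst (g t) p * MvPolynomial.X k))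
        ((starRingEnd ℂ) (g 0 k i) • L (polyGen Z p * MvPolynomial.X k) +
          (starRingEnd ℂ) (Z k i) • L (polySubst (g 0) p * MvPolynomial.X k)) 0 := fun k =>
      (hconj k).fun_smul (ih (L ∘ₗ LinearMap.mulRight ℂ (MvPolynomial.X k)))
    refine ((HasDerivAt.fun_sum fun k (_ : k ∈ Finset.univ) => hk k).congr_deriv ?_).congr_of_eventuallyEq
      (Filter.Eventually.of_forall fun t => ?_)
    · rw [Finset.sum_add_distrib, polyGen_mul_X, map_add, map_sum, h0, polySubst_one]
      congr 1
      · simp [Matrix.one_apply]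
      · simp only [map_smul, AlgHom.id_apply]
    · simp only [map_mul, polySubst_X, Finset.mul_sum, map_sum, mul_smul_comm, map_smul]

/-- Multiplication by the phase `exp(iθ)`. -/
def phase (n : ℕ) (θ : ℝ) : L2 n ≃ₗᵢ[ℂ] L2 n where
  __ := LinearEquiv.smulOfNeZero ℂ (L2 n) (Complex.exp (θ * Complex.I)) (Complex.exp_ne_zero _)
  norm_map' u := by
    change ‖Complex.exp (θ * Complex.I) • u‖ = ‖u‖
    rw [norm_smul, Complex.norm_exp_ofReal_mul_I, one_mul]

/-- The factor `1/2` offsets the `2` in `a_j = 2 ∂_j`. The result is the ladder part of `-iĤ`, since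
`-i · i/2 = 1/2`. -/
theorem hermiteFun_polyGen {n : ℕ} (A B : Matrix (Fin n) (Fin n) ℝ)
    (p : MvPolynomial (Fin n) ℂ) :
    hermiteFun n (polyGen (cplxMat A B) p) = (1 / 2 : ℂ) • ∑ k, ∑ j,
        ((B k j : ℂ) - Complex.I * A k j) • raise k (lower j (hermiteFun n p)) := by
  simp only [polyGen, map_sum, map_smul, hermiteFun_mul_X, lower_hermiteFun, Finset.smul_sum,
    smul_smul]
  refine Finset.sum_congr rfl fun k _ => Finset.sum_congr rfl fun j _ => ?_
  congr 1
  simp only [cplxMat_apply, map_add, map_mul, Complex.conj_ofReal, Complex.conj_I]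
  ring

theorem canonicalOp_symm {n : ℕ} (a : Fin n ⊕ Fin n) (f g : Sch n) :
    inner ℂ (toL2 n (canonicalOp a f)) (toL2 n g) =
      inner ℂ (toL2 n f) (toL2 n (canonicalOp a g)) := by
  rcases a with j | j
  · exact inner_mulX j f g
  · change inner ℂ (toL2 n ((-Complex.I) • partialX j f)) (toL2 n g) =
      inner ℂ (toL2 n f) (toL2 n ((-Complex.I) • partialX j g))
    rw [map_smul, map_smul, inner_smul_left, inner_smul_right, inner_partialX]
    simp

theorem weylQuadratic_symm {n : ℕ} (M : Matrix (Fin n ⊕ Fin n) (Fin n ⊕ Fin n) ℝ) (f g : Sch n) :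
    inner ℂ (toL2 n (weylQuadratic M f)) (toL2 n g) =
      inner ℂ (toL2 n f) (toL2 n (weylQuadratic M g)) := by
  simp only [weylQuadratic_apply, map_smul, map_sum, map_add, inner_smul_left, inner_smul_right,
    sum_inner, inner_sum, inner_add_left, inner_add_right, canonicalOp_symm, Complex.conj_ofReal,
    map_div₀, map_one, map_ofNat]
  congr 1
  refine Finset.sum_congr rfl fun a _ => Finset.sum_congr rfl fun b _ => ?_
  ring

/-- The Schrödinger group of the quadratic Hamiltonian with matrix `[[A, -B], [B, A]]`. -/
def schrodingerGroup {n : ℕ} {A B : Matrix (Fin n) (Fin n) ℝ} (hA : Aᵀ = A) (hB : Bᵀ = -B)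
    (t : ℝ) : L2 n ≃ₗᵢ[ℂ] L2 n :=
  phase n (-(t * A.trace / 2)) * metaRep n (expUnitary (cplxMat_mem_skewAdjoint hA hB) t)

section

variable {n : ℕ} {A B : Matrix (Fin n) (Fin n) ℝ} (hA : Aᵀ = A) (hB : Bᵀ = -B)

theorem schrodingerGroup_apply (t : ℝ) (u : L2 n) :
    schrodingerGroup hA hB t u = Complex.exp ((-(t * A.trace / 2) : ℝ) * Complex.I) •
      metaRep n (expUnitary (cplxMat_mem_skewAdjoint hA hB) t) u := rfl

theorem schrodingerGroup_hermiteL2 (t : ℝ) (p : MvPolynomial (Fin n) ℂ) :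
    ∃ q, schrodingerGroup hA hB t (hermiteL2 n p) = hermiteL2 n q :=
  ⟨_, by rw [schrodingerGroup_apply, metaRep_hermiteL2, ← map_smul]⟩

theorem isSchrodingerGroup_schrodingerGroup :
    IsSchrodingerGroup (weylQuadratic (Matrix.fromBlocks A (-B) B A))
      (schrodingerGroup hA hB) := by
  refine isSchrodingerGroup_of_hermiteL2 (weylQuadratic_symm _) ?_ (fun s t => ?_)
    (schrodingerGroup_hermiteL2 hA hB) (fun p => ?_)
  · refine LinearIsometryEquiv.ext fun u => ?_
    rw [schrodingerGroup_apply, expUnitary_zero, map_one]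
    simp
  · refine LinearIsometryEquiv.ext fun u => ?_
    change _ = schrodingerGroup hA hB s (schrodingerGroup hA hB t u)
    simp only [schrodingerGroup_apply, map_smul, smul_smul, expUnitary_add, map_mul]
    rw [← Complex.exp_add]
    refine congrArg₂ (· • ·) (congrArg Complex.exp ?_) rfl
    push_cast
    ring
  · have h1 := hasDerivAt_polySubst (g := fun t => NormedSpace.exp (t • cplxMat A B))
      (Z := cplxMat A B) (by simp [NormedSpace.exp_zero])
      (hasDerivAt_exp_smul_apply _) p (hermiteL2 n)
    -- The phase supplies the constant `-i tr A / 2` of `-iĤ`; the substitution supplies its ladder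
    -- part.
    have h2 : HasDerivAt (fun t : ℝ => Complex.exp ((-(t * A.trace / 2) : ℝ) * Complex.I))
        (-(A.trace / 2 : ℂ) * Complex.I) 0 := by
      have h3 : HasDerivAt (fun t : ℝ => ((-(t * A.trace / 2) : ℝ) : ℂ) * Complex.I)
          (-(A.trace / 2 : ℂ) * Complex.I) 0 := by
        have := ((((hasDerivAt_id (0 : ℝ)).mul_const A.trace).div_const 2).neg.ofReal_comp).mul_const
          Complex.I
        refine this.congr_deriv ?_
        push_cast
        simp
      simpa using h3.cexp
    refine ((h2.fun_smul h1).congr_deriv ?_).congr_of_eventuallyEq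
      (Filter.Eventually.of_forall fun t => ?_)
    · rw [weylQuadratic_eq_ladder hA hB, hermiteL2_apply (polyGen _ _), hermiteFun_polyGen]
      simp only [zero_smul, NormedSpace.exp_zero, polySubst_one, AlgHom.id_apply, hermiteL2_apply,
        zero_mul, zero_div, neg_zero, Complex.ofReal_zero, Complex.exp_zero, map_add,
        map_smul, smul_add, smul_smul]
      rw [add_comm]
      congr 2
      · ring
      · linear_combination (1 / 2 : ℂ) * Complex.I_mul_I
    · simp only [schrodingerGroup_apply, metaRep_hermiteL2, expUnitary_coe]

/-- The representation `metaRep` satisfies the defining property of the metaplectic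
representation. -/
theorem isMetaplecticRep_metaRep (n : ℕ) : IsMetaplecticRep (metaRep n) := by
  intro A B hA hB g hg
  refine ⟨schrodingerGroup hA hB, isSchrodingerGroup_schrodingerGroup hA hB, fun f => ?_⟩
  have hg' : expUnitary (cplxMat_mem_skewAdjoint hA hB) 1 = g := by
    ext1
    rw [expUnitary_coe, one_smul, hg]
    rfl
  rw [schrodingerGroup_apply, hg', smul_smul, ← Complex.exp_add]
  have : Complex.I * (A.trace : ℂ) / 2 + ((-(1 * A.trace / 2) : ℝ) : ℂ) * Complex.I = 0 := by
    push_cast; ring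
  rw [this, Complex.exp_zero, one_smul]

end

/-! ### Surjectivity of the exponential map and uniqueness -/

section Surjective

open scoped Matrix.Norms.L2Operator

/-- Every unitary matrix is `exp (iX)` for a Hermitian matrix `X`. -/
theorem exists_exp_eq_of_mem_unitaryGroup {n : ℕ} (g : Matrix.unitaryGroup (Fin n) ℂ) :
    ∃ X : Matrix (Fin n) (Fin n) ℂ, X.IsHermitian ∧
      NormedSpace.exp (Complex.I • X) = (g : Matrix (Fin n) (Fin n) ℂ) := by
  set u : Matrix (Fin n) (Fin n) ℂ := g.1 with hu
  have hmem : u ∈ unitary (Matrix (Fin n) (Fin n) ℂ) := g.2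
  have hn : IsStarNormal u := by
    rw [isStarNormal_iff, commute_iff_eq, (Unitary.mem_iff.1 hmem).1, (Unitary.mem_iff.1 hmem).2]
  -- `arg` jumps on the negative axis, but on a finite spectrum every function is continuous, so the
  -- functional calculus applies.
  have hfin : (spectrum ℂ u).Finite := Matrix.finite_spectrum u
  have hc : ContinuousOn (fun z : ℂ => (Complex.arg z : ℂ)) (spectrum ℂ u) := hfin.continuousOn _
  refine ⟨cfc (fun z : ℂ => (Complex.arg z : ℂ)) u, ?_, ?_⟩
  · have : IsSelfAdjoint (cfc (fun z : ℂ => (Complex.arg z : ℂ)) u) := by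
      rw [isSelfAdjoint_iff, ← cfc_star]
      simp
    exact this
  · rw [← CFC.exp_eq_normedSpace_exp (𝕜 := ℂ), ← cfc_comp_smul ..,
      ← cfc_comp' ..]
    conv_rhs => rw [← cfc_id' ℂ u]
    refine cfc_congr fun y hy => ?_
    have hy1 : ‖y‖ = 1 := spectrum.norm_eq_one_of_unitary hmem hy
    have hy0 : y ≠ 0 := by rintro rfl; simp at hy1
    have : Complex.I * y.arg = Complex.log y := by
      apply Complex.ext <;> simp [Complex.log_re, Complex.log_im, hy1]
    simpa [← Complex.exp_eq_exp_ℂ, this] using Complex.exp_log hy0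

end Surjective

/-- For Hermitian `X` one has `iX = -Im X + i Re X`, with `Re X` symmetric and `Im X`
skew-symmetric. -/
theorem exists_eq_exp_cplxMat {n : ℕ} (g : Matrix.unitaryGroup (Fin n) ℂ) :
    ∃ A B : Matrix (Fin n) (Fin n) ℝ, Aᵀ = A ∧ Bᵀ = -B ∧
      (g : Matrix (Fin n) (Fin n) ℂ) = NormedSpace.exp (cplxMat A B) := by
  obtain ⟨X, hX, hg⟩ := exists_exp_eq_of_mem_unitaryGroup g
  have hX' : ∀ i j, (starRingEnd ℂ) (X j i) = X i j := fun i j => hX.apply i j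
  refine ⟨X.map Complex.re, -X.map Complex.im, ?_, ?_, ?_⟩
  · ext i j
    simp [← hX' i j]
  · ext i j
    simp [← hX' i j]
  · rw [← hg]
    congr 1
    ext i j
    rw [cplxMat_apply]
    apply Complex.ext <;> simp

theorem IsMetaplecticRep.eq_metaRep {n : ℕ}
    {R : Matrix.unitaryGroup (Fin n) ℂ →* (L2 n ≃ₗᵢ[ℂ] L2 n)} (hR : IsMetaplecticRep R) :
    R = metaRep n := by
  refine MonoidHom.ext fun g => LinearIsometryEquiv.ext fun f => ?_
  obtain ⟨A, B, hA, hB, hg⟩ := exists_eq_exp_cplxMat g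
  obtain ⟨U, hU, h1⟩ := hR A B hA hB g hg
  obtain ⟨V, hV, h2⟩ := isMetaplecticRep_metaRep n A B hA hB g hg
  have hS := isSchrodingerGroup_schrodingerGroup hA hB
  rw [h1, h2, hU.eq_of_hermiteL2 hS (schrodingerGroup_hermiteL2 hA hB),
    hV.eq_of_hermiteL2 hS (schrodingerGroup_hermiteL2 hA hB)]

/-! ### Series of Schwartz functions -/

theorem sum_apply_schwartz {n : ℕ} {ι : Type*} (s : Finset ι) (f : ι → Sch n)
    (x : EuclideanSpace ℝ (Fin n)) : (∑ i ∈ s, f i) x = ∑ i ∈ s, f i x := by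
  classical
  induction s using Finset.induction_on with
  | empty => simp
  | insert a s ha ih => rw [Finset.sum_insert ha, Finset.sum_insert ha, add_apply, ih]

/-- A series of Schwartz functions whose seminorms are summable defines a Schwartz function. -/
theorem exists_schwartz_tsum {n : ℕ} (f : ℕ → Sch n)
    (hf : ∀ k l, Summable fun i => SchwartzMap.seminorm ℂ k l (f i)) :
    ∃ h : Sch n, (∀ x, h x = ∑' i, f i x) ∧
      ∀ k l, SchwartzMap.seminorm ℂ k l h ≤ ∑' i, SchwartzMap.seminorm ℂ k l (f i) := by
  have hb : ∀ (l i : ℕ) x, ‖iteratedFDeriv ℝ l (f i) x‖ ≤ SchwartzMap.seminorm ℂ 0 l (f i) :=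
    fun l i x => norm_iteratedFDeriv_le_seminorm ℂ (f i) l x
  have hsm : ∀ N : ℕ∞, ContDiff ℝ N fun x => ∑' i, f i x := fun N =>
    contDiff_tsum (v := fun l i => SchwartzMap.seminorm ℂ 0 l (f i)) (fun i => (f i).smooth N)
      (fun l _ => hf 0 l) (fun l i x _ => hb l i x)
  have hit : ∀ l x, iteratedFDeriv ℝ l (fun x => ∑' i, f i x) x =
      ∑' i, iteratedFDeriv ℝ l (f i) x := fun l x =>
    iteratedFDeriv_tsum_apply (N := ⊤) (v := fun l i => SchwartzMap.seminorm ℂ 0 l (f i))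
      (fun i => (f i).smooth ⊤) (fun l _ => hf 0 l) (fun l i x _ => hb l i x) le_top x
  have hdec : ∀ k l x, ‖x‖ ^ k * ‖iteratedFDeriv ℝ l (fun x => ∑' i, f i x) x‖ ≤
      ∑' i, SchwartzMap.seminorm ℂ k l (f i) := fun k l x => by
    have hs : Summable fun i => ‖iteratedFDeriv ℝ l (f i) x‖ :=
      Summable.of_nonneg_of_le (fun _ => norm_nonneg _) (fun i => hb l i x) (hf 0 l)
    rw [hit]
    calc ‖x‖ ^ k * ‖∑' i, iteratedFDeriv ℝ l (f i) x‖
        ≤ ‖x‖ ^ k * ∑' i, ‖iteratedFDeriv ℝ l (f i) x‖ := by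
          gcongr
          exact norm_tsum_le_tsum_norm hs
      _ = ∑' i, ‖x‖ ^ k * ‖iteratedFDeriv ℝ l (f i) x‖ := tsum_mul_left.symm
      _ ≤ _ := (hs.mul_left _).tsum_le_tsum (fun i => le_seminorm ℂ k l (f i) x) (hf k l)
  exact ⟨⟨fun x => ∑' i, f i x, hsm ⊤, fun k l => ⟨_, hdec k l⟩⟩, fun _ => rfl, fun k l =>
    seminorm_le_bound ℂ k l _ (tsum_nonneg fun i => apply_nonneg _ _) (hdec k l)⟩

/-- The remainder after `N` terms is the Schwartz sum of the shifted series, whose seminorms are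
bounded by tails of convergent series. -/
theorem exists_tendsto_schwartz_sum {n : ℕ} (f : ℕ → Sch n)
    (hf : ∀ k l, Summable fun i => SchwartzMap.seminorm ℂ k l (f i)) :
    ∃ h : Sch n, Filter.Tendsto (fun N => ∑ i ∈ Finset.range N, f i) Filter.atTop (nhds h) := by
  obtain ⟨h, hh, -⟩ := exists_schwartz_tsum f hf
  refine ⟨h, ((schwartz_withSeminorms ℂ (EuclideanSpace ℝ (Fin n)) ℂ).tendsto_nhds _ _).2 ?_⟩
  rintro ⟨k, l⟩ ε hε
  have ht := tendsto_sum_nat_add fun i => SchwartzMap.seminorm ℂ k l (f i)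
  filter_upwards [ht.eventually_lt_const hε] with N hN
  obtain ⟨r, hr, hr'⟩ := exists_schwartz_tsum (fun i => f (i + N)) fun k l =>
    (summable_nat_add_iff N).2 (hf k l)
  have hpt : ∀ x, Summable fun i => f i x := fun x =>
    Summable.of_norm_bounded (hf 0 0) fun i => norm_le_seminorm ℂ (f i) x
  have e : (∑ i ∈ Finset.range N, f i) - h = -r := by
    rw [sub_eq_iff_eq_add, neg_add_eq_sub, eq_sub_iff_add_eq]
    ext x
    rw [add_apply, hr, hh, ← (hpt x).sum_add_tsum_nat_add N]
    congr 1
    exact sum_apply_schwartz _ _ x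
  rw [e, schwartzSeminormFamily_apply, map_neg_eq_map]
  exact (hr' k l).trans_lt hN

/-! ### Schwartz seminorms are controlled by `L²` norms -/

theorem norm_toL2_sq {n : ℕ} (f : Sch n) : ‖toL2 n f‖ ^ 2 = ∫ x, ‖f x‖ ^ 2 := by
  have h := inner_toL2 f f
  rw [inner_self_eq_norm_sq_to_K] at h
  have h2 : ∀ x, f x * (starRingEnd ℂ) (f x) = ((‖f x‖ ^ 2 : ℝ) : ℂ) := fun x => by
    rw [Complex.mul_conj, Complex.normSq_eq_norm_sq]
  simp only [h2] at h
  rw [integral_complex_ofReal] at h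
  refine Complex.ofReal_injective (Eq.trans ?_ h)
  rw [Complex.ofReal_pow]
  rfl

/-- The operator `1 - Δ / (4π²)`. -/
def bessel (n : ℕ) : Module.End ℂ (Sch n) :=
  1 - (1 / (4 * Real.pi ^ 2) : ℂ) • ∑ j, (partialX j).toLinearMap * (partialX j).toLinearMap

theorem fourierInv_partialX {n : ℕ} (j : Fin n) (f : Sch n) (ξ : EuclideanSpace ℝ (Fin n)) :
    FourierTransformInv.fourierInv (partialX j f) ξ =
      -(2 * Real.pi * Complex.I) * ξ j * FourierTransformInv.fourierInv f ξ := by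
  have h := DFunLike.congr_fun
    (SchwartzMap.fourierInv_lineDerivOp_eq f (EuclideanSpace.single j (1 : ℝ))) ξ
  have ht : (fun x : EuclideanSpace ℝ (Fin n) =>
    inner ℝ x (EuclideanSpace.single j (1 : ℝ))).HasTemperateGrowth := by fun_prop
  refine h.trans ?_
  rw [smul_apply, SchwartzMap.smulLeftCLM_apply_apply ht]
  simp [EuclideanSpace.inner_single_right, mul_assoc]

/-- With the kernel `exp(2πi⟨x, ξ⟩)`, each derivative gives a factor `-2πi ξ_j`; the `1/(4π²)` in
`bessel` makes the multiplier exactly `1 + |ξ|²`. -/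
theorem fourierInv_bessel_pow {n : ℕ} (s : ℕ) (f : Sch n) (ξ : EuclideanSpace ℝ (Fin n)) :
    FourierTransformInv.fourierInv ((bessel n ^ s) f) ξ =
      ((1 + ‖ξ‖ ^ 2 : ℝ) : ℂ) ^ s * FourierTransformInv.fourierInv f ξ := by
  induction s with
  | zero => simp
  | succ s ih =>
    have h1 : ∀ g : Sch n, FourierTransformInv.fourierInv (bessel n g) ξ =
        ((1 + ‖ξ‖ ^ 2 : ℝ) : ℂ) * FourierTransformInv.fourierInv g ξ := fun g => by
      have e : bessel n g = g - (1 / (4 * Real.pi ^ 2) : ℂ) • ∑ j, partialX j (partialX j g) := by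
        simp [bessel]
      have hL : ∀ g : Sch n, FourierTransformInv.fourierInv g =
          FourierTransform.fourierInvCLM ℂ (Sch n) g := fun g => rfl
      rw [e, hL, map_sub, map_smul, map_sum, sub_apply, smul_apply, sum_apply_schwartz]
      simp only [← hL, fourierInv_partialX]
      have hpi : (Real.pi : ℂ) ≠ 0 := by exact_mod_cast Real.pi_ne_zero
      have hs : ∑ j, -(2 * Real.pi * Complex.I) * ξ j *
          (-(2 * Real.pi * Complex.I) * ξ j * FourierTransformInv.fourierInv g ξ) =
          -(4 * Real.pi ^ 2) * ((‖ξ‖ ^ 2 : ℝ) : ℂ) * FourierTransformInv.fourierInv g ξ := by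
        rw [EuclideanSpace.real_norm_sq_eq]
        push_cast
        rw [Finset.mul_sum, Finset.sum_mul]
        refine Finset.sum_congr rfl fun j _ => ?_
        linear_combination (4 * Real.pi ^ 2 * (ξ j : ℂ) ^ 2 *
          FourierTransformInv.fourierInv g ξ) * Complex.I_mul_I
      rw [hs, smul_eq_mul]
      push_cast
      field_simp
      ring
    rw [pow_succ', Module.End.mul_apply, h1, ih]
    ring

/-- The Sobolev inequality. -/
theorem exists_norm_apply_le (n : ℕ) : ∃ C : ℝ, 0 ≤ C ∧ ∀ (f : Sch n) x,
    ‖f x‖ ≤ C * ‖toL2 n ((bessel n ^ (n + 1)) f)‖ := by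
  -- Bound `f` by the `L¹` norm of its inverse transform, split off the weight `w`, and use
  -- Cauchy–Schwarz and Plancherel. The weight is in `L²` because `4(n + 1) > n`.
  set w : EuclideanSpace ℝ (Fin n) → ℝ := fun ξ => ((1 + ‖ξ‖ ^ 2) ^ (n + 1))⁻¹ with hw
  have hw0 : ∀ ξ, 0 ≤ w ξ := fun ξ => by positivity
  have hwc : Continuous w := by
    refine Continuous.inv₀ (by fun_prop) fun ξ => by positivity
  have hw2 : MemLp w 2 := by
    rw [memLp_two_iff_integrable_sq hwc.aestronglyMeasurable]
    have h := integrable_rpow_neg_one_add_norm_sq (E := EuclideanSpace ℝ (Fin n)) (μ := volume)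
      (r := ((4 * (n + 1) : ℕ) : ℝ)) (by
        rw [finrank_euclideanSpace_fin]
        exact_mod_cast (by omega : n < 4 * (n + 1)))
    refine h.congr (Filter.Eventually.of_forall fun ξ => ?_)
    have : (-((4 * (n + 1) : ℕ) : ℝ) / 2) = -((2 * (n + 1) : ℕ) : ℝ) := by push_cast; ring
    simp only [this, hw]
    rw [Real.rpow_neg (by positivity), Real.rpow_natCast, inv_pow, ← pow_mul, mul_comm 2]
  refine ⟨(∫ ξ, w ξ ^ (2 : ℝ)) ^ (1 / 2 : ℝ), Real.rpow_nonneg (integral_nonneg fun ξ =>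
    Real.rpow_nonneg (hw0 ξ) _) _, fun f x => ?_⟩
  set g : Sch n := FourierTransformInv.fourierInv ((bessel n ^ (n + 1)) f) with hg
  have h1 : ‖f x‖ ≤ ∫ ξ, ‖FourierTransformInv.fourierInv f ξ‖ := by
    have := norm_fourier_apply_le_toLp_one (FourierTransformInv.fourierInv f) x
    rwa [FourierTransform.fourier_fourierInv_eq, norm_toLp_one] at this
  have h2 : ∀ ξ, ‖FourierTransformInv.fourierInv f ξ‖ = w ξ * ‖g ξ‖ := fun ξ => by
    have hp : (0 : ℝ) < 1 + ‖ξ‖ ^ 2 := by positivity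
    rw [hg, fourierInv_bessel_pow, norm_mul, norm_pow, Complex.norm_real,
      Real.norm_of_nonneg hp.le, hw, inv_mul_cancel_left₀ (pow_pos hp _).ne']
  have h3 := integral_mul_le_Lp_mul_Lq_of_nonneg (μ := (volume : Measure (EuclideanSpace ℝ (Fin n))))
    Real.HolderConjugate.two_two (f := w) (g := fun ξ => ‖g ξ‖)
    (Filter.Eventually.of_forall hw0) (Filter.Eventually.of_forall fun _ => norm_nonneg _)
    (by simpa using hw2) (by simpa using (g.memLp 2 volume).norm)
  have h4 : (∫ ξ, ‖g ξ‖ ^ (2 : ℝ)) ^ (1 / 2 : ℝ) = ‖toL2 n ((bessel n ^ (n + 1)) f)‖ := by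
    have h5 := integral_norm_sq_fourier g
    rw [hg, FourierTransform.fourier_fourierInv_eq, ← hg] at h5
    simp only [Real.rpow_two]
    rw [← h5, ← norm_toL2_sq, ← Real.sqrt_eq_rpow, Real.sqrt_sq (norm_nonneg _)]
  rw [h4] at h3
  simp only [← h2] at h3
  exact h1.trans h3

/-- The algebra of polynomial differential operators, generated by the ladder operators. -/
def ladderAlgebra (n : ℕ) : Subalgebra ℂ (Module.End ℂ (Sch n)) :=
  Algebra.adjoin ℂ (Set.range lower ∪ Set.range raise)

theorem lower_mem {n : ℕ} (j : Fin n) : lower j ∈ ladderAlgebra n :=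
  Algebra.subset_adjoin (Or.inl ⟨j, rfl⟩)

theorem raise_mem {n : ℕ} (j : Fin n) : raise j ∈ ladderAlgebra n :=
  Algebra.subset_adjoin (Or.inr ⟨j, rfl⟩)

theorem mulX_mem {n : ℕ} (j : Fin n) : (mulX j).toLinearMap ∈ ladderAlgebra n := by
  have : (mulX j).toLinearMap = (1 / 2 : ℂ) • (lower j + raise j) :=
    LinearMap.ext fun f => mulX_eq j f
  rw [this]
  exact Subalgebra.smul_mem _ (add_mem (lower_mem j) (raise_mem j)) _

theorem partialX_mem {n : ℕ} (j : Fin n) : (partialX j).toLinearMap ∈ ladderAlgebra n := by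
  have : (partialX j).toLinearMap = (1 / 2 : ℂ) • (lower j - raise j) :=
    LinearMap.ext fun f => partialX_eq j f
  rw [this]
  exact Subalgebra.smul_mem _ (sub_mem (lower_mem j) (raise_mem j)) _

theorem bessel_mem (n : ℕ) : bessel n ∈ ladderAlgebra n :=
  sub_mem (one_mem _) (Subalgebra.smul_mem _
    (sum_mem fun j _ => mul_mem (partialX_mem j) (partialX_mem j)) _)

/-- Multiplication by `|x|²`. -/
def mulNormSq (n : ℕ) : Module.End ℂ (Sch n) :=
  ∑ j, (mulX j).toLinearMap * (mulX j).toLinearMap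

theorem mulNormSq_mem (n : ℕ) : mulNormSq n ∈ ladderAlgebra n :=
  sum_mem fun j _ => mul_mem (mulX_mem j) (mulX_mem j)

theorem mulNormSq_pow_apply {n : ℕ} (k : ℕ) (f : Sch n) (x : EuclideanSpace ℝ (Fin n)) :
    (mulNormSq n ^ k) f x = ((‖x‖ ^ (2 * k) : ℝ) : ℂ) * f x := by
  induction k with
  | zero => simp
  | succ k ih =>
    have h1 : ∀ g : Sch n, mulNormSq n g x = ((‖x‖ ^ 2 : ℝ) : ℂ) * g x := fun g => by
      have e : mulNormSq n g = ∑ j, mulX j (mulX j g) := by simp [mulNormSq]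
      rw [e, sum_apply_schwartz, EuclideanSpace.real_norm_sq_eq]
      push_cast
      rw [Finset.sum_mul]
      exact Finset.sum_congr rfl fun j _ => by rw [mulX_apply, mulX_apply]; ring
    rw [pow_succ', Module.End.mul_apply, h1, ih]
    push_cast
    ring

theorem exists_partialX_word {n l : ℕ} (r : Fin l → Fin n) :
    ∃ T ∈ ladderAlgebra n, ∀ (f : Sch n) x,
      T f x = iteratedFDeriv ℝ l f x fun i => EuclideanSpace.single (r i) (1 : ℝ) := by
  have h : ∀ {l : ℕ} (r : Fin l → Fin n), ∃ T ∈ ladderAlgebra n, ∀ f : Sch n,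
      T f = iteratedLineDerivOp (fun i => EuclideanSpace.single (r i) (1 : ℝ)) f := by
    intro l
    induction l with
    | zero => exact fun r => ⟨1, one_mem _, fun f => (iteratedLineDerivOp_fin_zero _ f).symm⟩
    | succ l ih =>
      intro r
      obtain ⟨T, hT, h⟩ := ih (Fin.tail r)
      refine ⟨(partialX (r 0)).toLinearMap * T, mul_mem (partialX_mem _) hT, fun f => ?_⟩
      rw [iteratedLineDerivOp_succ_left, Module.End.mul_apply, h]
      rfl
  obtain ⟨T, hT, hT'⟩ := h r
  exact ⟨T, hT, fun f x => by rw [hT', SchwartzMap.iteratedLineDerivOp_eq_iteratedFDeriv]⟩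

theorem norm_multilinear_le_sum {n l : ℕ}
    (m : ContinuousMultilinearMap ℝ (fun _ : Fin l => EuclideanSpace ℝ (Fin n)) ℂ) :
    ‖m‖ ≤ ∑ r : Fin l → Fin n, ‖m fun i => EuclideanSpace.single (r i) (1 : ℝ)‖ := by
  refine ContinuousMultilinearMap.opNorm_le_bound (Finset.sum_nonneg fun _ _ => norm_nonneg _)
    fun v => ?_
  have hv : v = fun i => ∑ j, (v i j) • EuclideanSpace.single j (1 : ℝ) := by
    ext i k
    simp [Pi.single_apply]
  conv_lhs => rw [hv]
  rw [ContinuousMultilinearMap.map_sum]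
  refine (norm_sum_le _ _).trans ?_
  rw [Finset.sum_mul]
  refine Finset.sum_le_sum fun r _ => ?_
  rw [ContinuousMultilinearMap.map_smul_univ, norm_smul, mul_comm, norm_prod]
  gcongr with i
  exact PiLp.norm_apply_le (v i) (r i)

/-- Schwartz seminorms are controlled by `L²` norms of polynomial differential operators. -/
theorem exists_seminorm_le (n k l : ℕ) : ∃ (C : ℝ) (T : (Fin l → Fin n) → Module.End ℂ (Sch n)),
    0 ≤ C ∧ (∀ r, T r ∈ ladderAlgebra n) ∧
      ∀ f : Sch n, SchwartzMap.seminorm ℂ k l f ≤ C * ∑ r, ‖toL2 n (T r f)‖ := by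
  obtain ⟨C, hC, hS⟩ := exists_norm_apply_le n
  choose D hD hD' using fun r : Fin l → Fin n => exists_partialX_word r
  -- The weight `1 + |x|^(2k)` dominates `|x|^k` and, unlike it, is always a polynomial in the
  -- coordinates; the power of `bessel` comes from the Sobolev inequality.
  refine ⟨C, fun r => bessel n ^ (n + 1) * ((1 + mulNormSq n ^ k) * D r), hC, fun r =>
    mul_mem (pow_mem (bessel_mem n) _) (mul_mem (add_mem (one_mem _)
      (pow_mem (mulNormSq_mem n) _)) (hD r)), fun f => ?_⟩
  refine seminorm_le_bound ℂ k l f (mul_nonneg hC (Finset.sum_nonneg fun _ _ => norm_nonneg _))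
    fun x => ?_
  calc ‖x‖ ^ k * ‖iteratedFDeriv ℝ l f x‖
      ≤ (1 + ‖x‖ ^ (2 * k)) * ∑ r : Fin l → Fin n, ‖D r f x‖ := by
        refine mul_le_mul ?_ ?_ (norm_nonneg _) (by positivity)
        · rw [mul_comm 2, pow_mul]; nlinarith [sq_nonneg (‖x‖ ^ k - 1)]
        · simp only [hD']
          exact norm_multilinear_le_sum _
    _ = ∑ r : Fin l → Fin n, ‖((1 + mulNormSq n ^ k) * D r) f x‖ := by
        rw [Finset.mul_sum]
        refine Finset.sum_congr rfl fun r _ => ?_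
        have e : ((1 + mulNormSq n ^ k) * D r) f x = ((1 + ‖x‖ ^ (2 * k) : ℝ) : ℂ) * D r f x := by
          have : ((1 + mulNormSq n ^ k) * D r) f = D r f + (mulNormSq n ^ k) (D r f) := by
            simp [add_mul]
          rw [this, add_apply, mulNormSq_pow_apply]
          push_cast
          ring
        rw [e, norm_mul, Complex.norm_real, Real.norm_of_nonneg (by positivity)]
    _ ≤ ∑ r : Fin l → Fin n,
        C * ‖toL2 n ((bessel n ^ (n + 1)) (((1 + mulNormSq n ^ k) * D r) f))‖ :=
        Finset.sum_le_sum fun r _ => hS _ x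
    _ = _ := by rw [← Finset.mul_sum]; rfl

/-! ### The number operator -/

/-- The operator `∑_j a_j† a_j`. -/
def numOp (n : ℕ) : Module.End ℂ (Sch n) := ∑ j, raise j * lower j

theorem numOp_apply {n : ℕ} (f : Sch n) : numOp n f = ∑ j, raise j (lower j f) := by
  simp [numOp]

theorem inner_numOp {n : ℕ} (f g : Sch n) :
    inner ℂ (toL2 n (numOp n f)) (toL2 n g) = inner ℂ (toL2 n f) (toL2 n (numOp n g)) := by
  simp only [numOp_apply, map_sum, sum_inner, inner_sum]
  exact Finset.sum_congr rfl fun j _ => by rw [inner_raise, inner_lower]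

/-- On polynomials the operator is `2 ∑_j X_j ∂_j`, so this is Euler's identity for homogeneous
polynomials. -/
theorem numOp_hermiteFun {n k : ℕ} {p : MvPolynomial (Fin n) ℂ} (hp : p.IsHomogeneous k) :
    numOp n (hermiteFun n p) = (2 * k : ℂ) • hermiteFun n p := by
  have h := hp.sum_X_mul_pderiv
  rw [numOp_apply]
  simp only [lower_hermiteFun, ← hermiteFun_mul_X]
  rw [← map_sum, ← map_smul]
  congr 1
  have e : ∀ j : Fin n, (2 : ℂ) • MvPolynomial.pderiv j p * MvPolynomial.X j =
      (2 : ℂ) • (MvPolynomial.X j * MvPolynomial.pderiv j p) := fun j => by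
    rw [smul_mul_assoc, mul_comm]
  simp only [e]
  rw [← Finset.smul_sum, h, mul_smul, Nat.cast_smul_eq_nsmul]

/-- Eigenvectors of the symmetric operator `numOp` for the distinct eigenvalues `2i` and `2j` are
orthogonal. -/
theorem inner_hermiteL2_of_ne {n i j : ℕ} {p q : MvPolynomial (Fin n) ℂ} (hp : p.IsHomogeneous i)
    (hq : q.IsHomogeneous j) (hij : i ≠ j) : inner ℂ (hermiteL2 n p) (hermiteL2 n q) = 0 := by
  have h := inner_numOp (hermiteFun n p) (hermiteFun n q)
  rw [numOp_hermiteFun hp, numOp_hermiteFun hq, map_smul, map_smul, inner_smul_left,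
    inner_smul_right] at h
  simp only [map_mul, map_ofNat, map_natCast] at h
  have h2 : ((i : ℂ) - j) * inner ℂ (hermiteL2 n p) (hermiteL2 n q) = 0 := by
    simp only [hermiteL2_apply]
    linear_combination h / 2
  rcases mul_eq_zero.1 h2 with h3 | h3
  · exact absurd (Nat.cast_injective (sub_eq_zero.1 h3)) hij
  · exact h3

/-! ### Polynomial bounds for ladder operators -/

theorem sum_homogeneousComponent_of_le {n k : ℕ} {p : MvPolynomial (Fin n) ℂ}
    (hp : p.totalDegree ≤ k) :
    ∑ i ∈ Finset.range (k + 1), MvPolynomial.homogeneousComponent i p = p := by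
  conv_rhs => rw [← MvPolynomial.sum_homogeneousComponent p]
  refine (Finset.sum_subset (Finset.range_subset_range.2 (by omega)) fun i _ hi => ?_).symm
  refine MvPolynomial.homogeneousComponent_eq_zero _ _ ?_
  rw [Finset.mem_range] at hi
  omega

theorem totalDegree_pderiv_le {n : ℕ} (j : Fin n) (p : MvPolynomial (Fin n) ℂ) :
    (MvPolynomial.pderiv j p).totalDegree ≤ p.totalDegree := by
  have e : MvPolynomial.pderiv j p = ∑ i ∈ Finset.range (p.totalDegree + 1),
      MvPolynomial.pderiv j (MvPolynomial.homogeneousComponent i p) := by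
    rw [← map_sum, sum_homogeneousComponent_of_le le_rfl]
  rw [e]
  refine MvPolynomial.totalDegree_finsetSum_le fun i hi => ?_
  have h := (MvPolynomial.homogeneousComponent_isHomogeneous i p).pderiv (i := j)
  have := h.totalDegree_le
  rw [Finset.mem_range] at hi
  omega

/-- The sum over `j` of the left sides is the quadratic form of `numOp`, which is diagonal in the
homogeneous components, with eigenvalues at most `2k`. -/
theorem norm_lower_hermiteL2_sq_le {n k : ℕ} {p : MvPolynomial (Fin n) ℂ} (hp : p.totalDegree ≤ k)
    (j : Fin n) :
    ‖toL2 n (lower j (hermiteFun n p))‖ ^ 2 ≤ 2 * k * ‖hermiteL2 n p‖ ^ 2 := by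
  set P : ℕ → L2 n := fun i => hermiteL2 n (MvPolynomial.homogeneousComponent i p) with hP
  have hPo : ∀ i i', i ≠ i' → inner ℂ (P i) (P i') = 0 := fun i i' h =>
    inner_hermiteL2_of_ne (MvPolynomial.homogeneousComponent_isHomogeneous i p)
      (MvPolynomial.homogeneousComponent_isHomogeneous i' p) h
  have hsum : hermiteL2 n p = ∑ i ∈ Finset.range (k + 1), P i := by
    conv_lhs => rw [← sum_homogeneousComponent_of_le hp, map_sum]
  have hnum : toL2 n (numOp n (hermiteFun n p)) =
      ∑ i ∈ Finset.range (k + 1), (2 * i : ℂ) • P i := by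
    conv_lhs => rw [← sum_homogeneousComponent_of_le hp, map_sum, map_sum, map_sum]
    refine Finset.sum_congr rfl fun i _ => ?_
    rw [numOp_hermiteFun (MvPolynomial.homogeneousComponent_isHomogeneous i p), map_smul]
    rfl
  have hdiag : ∀ c : ℕ → ℂ, inner ℂ (hermiteL2 n p) (∑ i ∈ Finset.range (k + 1), c i • P i) =
      ∑ i ∈ Finset.range (k + 1), c i * ((‖P i‖ ^ 2 : ℝ) : ℂ) := fun c => by
    rw [hsum, inner_sum]
    refine Finset.sum_congr rfl fun i hi => ?_
    rw [inner_smul_right, sum_inner, Finset.sum_eq_single i (fun i' _ h => hPo i' i h)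
      (fun h => absurd hi h), inner_self_eq_norm_sq_to_K, Complex.ofReal_pow]
    rfl
  have h1 : ‖hermiteL2 n p‖ ^ 2 = ∑ i ∈ Finset.range (k + 1), ‖P i‖ ^ 2 := by
    have h := hdiag fun _ => 1
    simp only [one_smul, one_mul] at h
    rw [← hsum, inner_self_eq_norm_sq_to_K, ← Complex.ofReal_sum] at h
    refine Complex.ofReal_injective (Eq.trans ?_ h)
    rw [Complex.ofReal_pow]
    rfl
  have h2 : ∑ j, ‖toL2 n (lower j (hermiteFun n p))‖ ^ 2 =
      ∑ i ∈ Finset.range (k + 1), 2 * i * ‖P i‖ ^ 2 := by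
    have h := hdiag fun i => 2 * i
    rw [← hnum, numOp_apply, map_sum, inner_sum, hermiteL2_apply] at h
    have e : ∀ j, inner ℂ (toL2 n (hermiteFun n p)) (toL2 n (raise j (lower j (hermiteFun n p)))) =
        ((‖toL2 n (lower j (hermiteFun n p))‖ ^ 2 : ℝ) : ℂ) := fun j => by
      rw [← inner_lower, inner_self_eq_norm_sq_to_K, Complex.ofReal_pow]
      rfl
    simp only [e] at h
    exact_mod_cast h
  calc ‖toL2 n (lower j (hermiteFun n p))‖ ^ 2
      ≤ ∑ j, ‖toL2 n (lower j (hermiteFun n p))‖ ^ 2 :=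
        Finset.single_le_sum (f := fun j => ‖toL2 n (lower j (hermiteFun n p))‖ ^ 2)
          (fun _ _ => sq_nonneg _) (Finset.mem_univ j)
    _ ≤ ∑ i ∈ Finset.range (k + 1), 2 * k * ‖P i‖ ^ 2 := by
        rw [h2]
        refine Finset.sum_le_sum fun i hi => ?_
        have : (i : ℝ) ≤ k := by
          exact_mod_cast Nat.lt_succ_iff.1 (Finset.mem_range.1 hi)
        gcongr
    _ = _ := by rw [h1, Finset.mul_sum]

theorem norm_raise_hermiteL2_sq {n : ℕ} (j : Fin n) (f : Sch n) :
    ‖toL2 n (raise j f)‖ ^ 2 = ‖toL2 n (lower j f)‖ ^ 2 + 2 * ‖toL2 n f‖ ^ 2 := by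
  have h : inner ℂ (toL2 n (raise j f)) (toL2 n (raise j f)) =
      inner ℂ (toL2 n (lower j f)) (toL2 n (lower j f)) +
        2 * inner ℂ (toL2 n f) (toL2 n f) := by
    rw [inner_raise, lower_raise, if_pos rfl, map_add, inner_add_right, ← inner_lower, map_smul,
      inner_smul_right]
  simp only [inner_self_eq_norm_sq_to_K] at h
  refine Complex.ofReal_injective ?_
  push_cast
  exact h

/-- An operator that raises degrees of Hermite functions by a bounded amount and whose norm on
Hermite functions grows polynomially with the degree. -/
def HasPolyBound {n : ℕ} (T : Module.End ℂ (Sch n)) : Prop :=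
  ∃ (C : ℝ) (M d : ℕ), 0 ≤ C ∧ ∀ (k : ℕ) (p : MvPolynomial (Fin n) ℂ), p.totalDegree ≤ k →
    ∃ q : MvPolynomial (Fin n) ℂ, q.totalDegree ≤ k + d ∧ T (hermiteFun n p) = hermiteFun n q ∧
      ‖hermiteL2 n q‖ ≤ C * (1 + k) ^ M * ‖hermiteL2 n p‖

/-- The true growth is `√(2k)`; the cruder bound `2(1 + k)` suffices. -/
theorem hasPolyBound_lower {n : ℕ} (j : Fin n) : HasPolyBound (lower j) := by
  refine ⟨2, 1, 0, by norm_num, fun k p hp => ⟨_, ?_, lower_hermiteFun j p, ?_⟩⟩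
  · refine (MvPolynomial.totalDegree_smul_le _ _).trans ?_
    exact (totalDegree_pderiv_le _ _).trans hp
  · have h := norm_lower_hermiteL2_sq_le hp j
    rw [lower_hermiteFun, ← hermiteL2_apply] at h
    refine le_of_sq_le_sq ?_ (by positivity)
    nlinarith [sq_nonneg (‖hermiteL2 n p‖), sq_nonneg ((k : ℝ) * ‖hermiteL2 n p‖),
      mul_nonneg (Nat.cast_nonneg (α := ℝ) k) (sq_nonneg (‖hermiteL2 n p‖))]

theorem hasPolyBound_raise {n : ℕ} (j : Fin n) : HasPolyBound (raise j) := by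
  refine ⟨2, 1, 1, by norm_num, fun k p hp => ⟨_, ?_, (hermiteFun_mul_X p j).symm, ?_⟩⟩
  · refine (MvPolynomial.totalDegree_mul _ _).trans ?_
    rw [MvPolynomial.totalDegree_X]
    omega
  · have h := norm_lower_hermiteL2_sq_le hp j
    have h2 := norm_raise_hermiteL2_sq j (hermiteFun n p)
    rw [← hermiteFun_mul_X, ← hermiteL2_apply, ← hermiteL2_apply] at h2
    refine le_of_sq_le_sq ?_ (by positivity)
    nlinarith [sq_nonneg (‖hermiteL2 n p‖), sq_nonneg ((k : ℝ) * ‖hermiteL2 n p‖),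
      mul_nonneg (Nat.cast_nonneg (α := ℝ) k) (sq_nonneg (‖hermiteL2 n p‖))]

theorem HasPolyBound.add {n : ℕ} {S T : Module.End ℂ (Sch n)} (hS : HasPolyBound S)
    (hT : HasPolyBound T) : HasPolyBound (S + T) := by
  obtain ⟨C, M, d, hC, hS⟩ := hS
  obtain ⟨C', M', d', hC', hT⟩ := hT
  refine ⟨C + C', M + M', d + d', by positivity, fun k p hp => ?_⟩
  obtain ⟨q, hq, hq1, hq2⟩ := hS k p hp
  obtain ⟨r, hr, hr1, hr2⟩ := hT k p hp
  refine ⟨q + r, (MvPolynomial.totalDegree_add _ _).trans (by omega), ?_, ?_⟩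
  · rw [LinearMap.add_apply, hq1, hr1, map_add]
  · have h1 : (1 : ℝ) ≤ 1 + k := by linarith [Nat.cast_nonneg (α := ℝ) k]
    have ha : C * (1 + k : ℝ) ^ M ≤ C * (1 + k : ℝ) ^ (M + M') := by gcongr; omega
    have hb : C' * (1 + k : ℝ) ^ M' ≤ C' * (1 + k : ℝ) ^ (M + M') := by gcongr; omega
    calc ‖hermiteL2 n (q + r)‖ ≤ ‖hermiteL2 n q‖ + ‖hermiteL2 n r‖ := by
          rw [map_add]; exact norm_add_le _ _
      _ ≤ C * (1 + k : ℝ) ^ (M + M') * ‖hermiteL2 n p‖ +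
          C' * (1 + k : ℝ) ^ (M + M') * ‖hermiteL2 n p‖ := by
          refine add_le_add (hq2.trans ?_) (hr2.trans ?_) <;> gcongr
      _ = _ := by ring

theorem HasPolyBound.mul {n : ℕ} {S T : Module.End ℂ (Sch n)} (hS : HasPolyBound S)
    (hT : HasPolyBound T) : HasPolyBound (S * T) := by
  obtain ⟨C, M, d, hC, hS⟩ := hS
  obtain ⟨C', M', d', hC', hT⟩ := hT
  -- `S` acts on degree up to `k + d'`, and `1 + k + d' ≤ (1 + d')(1 + k)` yields the factor `(1 +
  -- d')^M`.
  refine ⟨C * (1 + d') ^ M * C', M + M', d + d', by positivity, fun k p hp => ?_⟩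
  obtain ⟨q, hq, hq1, hq2⟩ := hT k p hp
  obtain ⟨r, hr, hr1, hr2⟩ := hS _ q hq
  refine ⟨r, by omega, by rw [Module.End.mul_apply, hq1, hr1], hr2.trans ?_⟩
  have h1 : (1 + ((k + d' : ℕ) : ℝ)) ≤ (1 + d') * (1 + k) := by
    push_cast
    nlinarith [mul_nonneg (Nat.cast_nonneg (α := ℝ) k) (Nat.cast_nonneg (α := ℝ) d')]
  calc C * (1 + ((k + d' : ℕ) : ℝ)) ^ M * ‖hermiteL2 n q‖
      ≤ C * ((1 + d') * (1 + k)) ^ M * (C' * (1 + k) ^ M' * ‖hermiteL2 n p‖) := by gcongr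
    _ = _ := by rw [mul_pow, pow_add]; ring

theorem hasPolyBound_of_mem {n : ℕ} {T : Module.End ℂ (Sch n)} (hT : T ∈ ladderAlgebra n) :
    HasPolyBound T := by
  induction hT using Algebra.adjoin_induction with
  | mem T hT =>
    rcases hT with ⟨j, rfl⟩ | ⟨j, rfl⟩
    · exact hasPolyBound_lower j
    · exact hasPolyBound_raise j
  | algebraMap c =>
    refine ⟨‖c‖, 0, 0, norm_nonneg _, fun k p hp => ⟨c • p, ?_, ?_, ?_⟩⟩
    · exact (MvPolynomial.totalDegree_smul_le _ _).trans hp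
    · rw [Module.algebraMap_end_apply, map_smul]
    · rw [map_smul, norm_smul, pow_zero, mul_one]
  | add S T _ _ hS hT => exact hS.add hT
  | mul S T _ _ hS hT => exact hS.mul hT

/-- Schwartz seminorms of Hermite functions are polynomially bounded in the degree. -/
theorem exists_seminorm_hermiteFun_le (n k l : ℕ) : ∃ (C : ℝ) (M : ℕ), 0 ≤ C ∧
    ∀ (m : ℕ) (p : MvPolynomial (Fin n) ℂ), p.totalDegree ≤ m →
      SchwartzMap.seminorm ℂ k l (hermiteFun n p) ≤ C * (1 + m) ^ M * ‖hermiteL2 n p‖ := by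
  obtain ⟨C, T, hC, hT, h⟩ := exists_seminorm_le n k l
  choose D M d hD hb using fun r => hasPolyBound_of_mem (hT r)
  refine ⟨C * ∑ r, D r, ∑ r, M r, mul_nonneg hC (Finset.sum_nonneg fun r _ => hD r),
    fun m p hp => (h _).trans ?_⟩
  rw [mul_assoc, mul_assoc, Finset.sum_mul]
  refine mul_le_mul_of_nonneg_left (Finset.sum_le_sum fun r _ => ?_) hC
  obtain ⟨q, -, hq1, hq2⟩ := hb r m p hp
  rw [hq1, ← hermiteL2_apply, ← mul_assoc]
  refine hq2.trans ?_
  have h1 : (1 : ℝ) ≤ 1 + m := by linarith [Nat.cast_nonneg (α := ℝ) m]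
  have h2 : M r ≤ ∑ r, M r := Finset.single_le_sum (fun _ _ => Nat.zero_le _) (Finset.mem_univ r)
  have h3 := hD r
  gcongr

/-! ### The metaplectic representation preserves Schwartz functions -/

theorem polySubst_isHomogeneous {n k : ℕ} (g : Matrix (Fin n) (Fin n) ℂ)
    {p : MvPolynomial (Fin n) ℂ} (hp : p.IsHomogeneous k) : (polySubst g p).IsHomogeneous k := by
  have h := hp.aeval (fun j => ∑ k, (starRingEnd ℂ) (g k j) • MvPolynomial.X k)
    (n := 1) fun j => MvPolynomial.IsHomogeneous.sum _ _ _ fun i _ =>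
      (MvPolynomial.homogeneousSubmodule (Fin n) ℂ 1).smul_mem _ (MvPolynomial.isHomogeneous_X ℂ i)
  rwa [one_mul] at h

/-- The space of Hermite functions of degree `m`. -/
def hermiteSpace (n m : ℕ) : Submodule ℂ (L2 n) :=
  (MvPolynomial.homogeneousSubmodule (Fin n) ℂ m).map (hermiteL2 n)

/-- Finite dimension provides the orthogonal projection onto this space. -/
instance (n m : ℕ) : FiniteDimensional ℂ (hermiteSpace n m) := by
  have : (MvPolynomial.homogeneousSubmodule (Fin n) ℂ m).FG :=
    MvPolynomial.homogeneousSubmodule_fg (Fin n) ℂ m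
  exact Module.Finite.iff_fg.2 (this.map _)

theorem mem_hermiteSpace {n m : ℕ} {p : MvPolynomial (Fin n) ℂ} (hp : p.IsHomogeneous m) :
    hermiteL2 n p ∈ hermiteSpace n m :=
  Submodule.mem_map_of_mem hp

/-- A Schwartz function has rapidly decreasing Hermite coefficients. -/
theorem norm_starProjection_hermiteSpace_le {n : ℕ} (f : Sch n) (N m : ℕ) :
    (1 + m : ℝ) ^ N * ‖(hermiteSpace n m).starProjection (toL2 n f)‖ ≤
      ‖toL2 n (((1 + numOp n) ^ N) f)‖ := by
  -- The space consists of eigenvectors of the symmetric operator `1 + numOp n` with eigenvalue `1 +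
  -- 2m`, so the projection turns that operator into this scalar.
  have h1 : ∀ g : Sch n, (hermiteSpace n m).starProjection (toL2 n ((1 + numOp n) g)) =
      (1 + 2 * m : ℂ) • (hermiteSpace n m).starProjection (toL2 n g) := fun g => by
    refine Submodule.eq_starProjection_of_mem_of_inner_eq_zero
      (Submodule.smul_mem _ _ (Submodule.starProjection_apply_mem _ _)) ?_
    rintro _ ⟨p, hp, rfl⟩
    have h2 := Submodule.starProjection_inner_eq_zero (K := hermiteSpace n m) (toL2 n g) _
      (mem_hermiteSpace hp)
    rw [inner_sub_left, sub_eq_zero] at h2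
    rw [inner_sub_left, sub_eq_zero, inner_smul_left, ← h2, hermiteL2_apply, LinearMap.add_apply,
      map_add, inner_add_left, inner_numOp, numOp_hermiteFun hp, map_smul, inner_smul_right]
    simp only [Module.End.one_apply, map_add, map_one, map_mul, map_ofNat, map_natCast]
    ring
  have h2 : (hermiteSpace n m).starProjection (toL2 n (((1 + numOp n) ^ N) f)) =
      (1 + 2 * m : ℂ) ^ N • (hermiteSpace n m).starProjection (toL2 n f) := by
    induction N with
    | zero => simp
    | succ N ih => rw [pow_succ', Module.End.mul_apply, h1, ih, smul_smul, ← pow_succ']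
  calc (1 + m : ℝ) ^ N * ‖(hermiteSpace n m).starProjection (toL2 n f)‖
      ≤ ‖(1 + 2 * m : ℂ) ^ N‖ * ‖(hermiteSpace n m).starProjection (toL2 n f)‖ := by
        have : (1 + 2 * m : ℂ) = ((1 + 2 * m : ℝ) : ℂ) := by push_cast; rfl
        rw [norm_pow, this, Complex.norm_real, Real.norm_of_nonneg (by positivity)]
        gcongr
        linarith [Nat.cast_nonneg (α := ℝ) m]
    _ = ‖(hermiteSpace n m).starProjection (toL2 n (((1 + numOp n) ^ N) f))‖ := by
        rw [h2, norm_smul]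
    _ ≤ _ := Submodule.norm_starProjection_apply_le _ _

/-- Apply the substitution to each Hermite component of `f`. Rapid decay of the components beats the
polynomial growth of the seminorms, so the series converges in the Schwartz space. Its sum is
identified with `R_g f` by pairing with Hermite functions of each degree, only one term
contributing. -/
theorem exists_metaRep_toL2 {n : ℕ} (g : Matrix.unitaryGroup (Fin n) ℂ) (f : Sch n) :
    ∃ h : Sch n, metaRep n g (toL2 n f) = toL2 n h := by
  have hP : ∀ m, ∃ p : MvPolynomial (Fin n) ℂ, p.IsHomogeneous m ∧
      hermiteL2 n p = (hermiteSpace n m).starProjection (toL2 n f) := fun m => by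
    obtain ⟨p, hp, h⟩ := Submodule.starProjection_apply_mem (hermiteSpace n m) (toL2 n f)
    exact ⟨p, hp, h⟩
  choose p hp hpf using hP
  have hq : ∀ m, (polySubst (g : Matrix (Fin n) (Fin n) ℂ) (p m)).IsHomogeneous m := fun m =>
    polySubst_isHomogeneous _ (hp m)
  have hsum : ∀ k l, Summable fun m => SchwartzMap.seminorm ℂ k l
      (hermiteFun n (polySubst (g : Matrix (Fin n) (Fin n) ℂ) (p m))) := fun k l => by
    obtain ⟨C, M, hC, h⟩ := exists_seminorm_hermiteFun_le n k l
    -- Of the exponent `M + 2`, the `M` compensates the growth of the seminorm and the `2` leaves a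
    -- summable `1/(m + 1)²`.
    have hs : Summable fun m : ℕ => C * ‖toL2 n (((1 + numOp n) ^ (M + 2)) f)‖ *
        (1 / ((m : ℝ) + 1) ^ 2) := by
      refine Summable.mul_left _ ?_
      have := (summable_nat_add_iff 1).2 (Real.summable_one_div_nat_pow.2 one_lt_two)
      simpa using this
    refine Summable.of_nonneg_of_le (fun m => apply_nonneg _ _) (fun m => ?_) hs
    refine (h m _ (hq m).totalDegree_le).trans ?_
    have h1 := norm_starProjection_hermiteSpace_le f (M + 2) m
    rw [← metaRep_hermiteL2, LinearIsometryEquiv.norm_map, hpf, mul_one_div,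
      le_div_iff₀ (by positivity)]
    calc C * (1 + m) ^ M * ‖(hermiteSpace n m).starProjection (toL2 n f)‖ * ((m : ℝ) + 1) ^ 2
        = C * ((1 + m : ℝ) ^ (M + 2) * ‖(hermiteSpace n m).starProjection (toL2 n f)‖) := by ring
      _ ≤ _ := by gcongr
  obtain ⟨h, hh⟩ := exists_tendsto_schwartz_sum _ hsum
  refine ⟨h, ext_inner_hermiteL2 fun r => ?_⟩
  have hhom : ∀ (j : ℕ) (r : MvPolynomial (Fin n) ℂ), r.IsHomogeneous j →
      inner ℂ (hermiteL2 n r) (metaRep n g (toL2 n f)) = inner ℂ (hermiteL2 n r) (toL2 n h) := by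
    intro j r hr
    have hterm : ∀ m, inner ℂ (hermiteL2 n r)
        (toL2 n (hermiteFun n (polySubst (g : Matrix (Fin n) (Fin n) ℂ) (p m)))) =
        if m = j then inner ℂ (hermiteL2 n r) (metaRep n g (toL2 n f)) else 0 := fun m => by
      split_ifs with hm
      · subst hm
        rw [← hermiteL2_apply, ← metaRep_hermiteL2, inner_metaRep_right, inner_metaRep_right,
          metaRep_hermiteL2, hpf, ← sub_eq_zero, ← inner_sub_right, ← inner_conj_symm,
          ← neg_sub, inner_neg_left, Submodule.starProjection_inner_eq_zero _ _
            (mem_hermiteSpace (polySubst_isHomogeneous _ hr))]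
        simp
      · exact inner_hermiteL2_of_ne hr (hq m) (Ne.symm hm)
    have hlim := ((toL2 n).continuous.tendsto h).comp hh
    have hlim2 := Filter.Tendsto.inner (𝕜 := ℂ) (tendsto_const_nhds (x := hermiteL2 n r)) hlim
    refine tendsto_nhds_unique (Filter.Tendsto.congr' ?_ tendsto_const_nhds) hlim2
    filter_upwards [Filter.eventually_gt_atTop j] with N hN
    simp only [Function.comp_apply, map_sum, inner_sum, hterm]
    simp [hN]
  rw [← MvPolynomial.sum_homogeneousComponent r, map_sum, sum_inner, sum_inner]
  exact Finset.sum_congr rfl fun i _ =>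
    hhom i _ (MvPolynomial.homogeneousComponent_isHomogeneous i r)

/-! ### The action of `U(n)` on Schwartz functions -/

theorem toL2_injective (n : ℕ) : Function.Injective (toL2 n) :=
  SchwartzMap.injective_toLp 2 volume

/-- The restriction of the metaplectic representation to Schwartz functions. -/
def schwartzRep {n : ℕ} (g : Matrix.unitaryGroup (Fin n) ℂ) : Sch n →ₗ[ℂ] Sch n where
  toFun f := (exists_metaRep_toL2 g f).choose
  map_add' f f' := toL2_injective n <| by
    refine (exists_metaRep_toL2 g (f + f')).choose_spec.symm.trans ?_
    rw [map_add, map_add, map_add]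
    exact congrArg₂ _ (exists_metaRep_toL2 g f).choose_spec (exists_metaRep_toL2 g f').choose_spec
  map_smul' c f := toL2_injective n <| by
    refine (exists_metaRep_toL2 g (c • f)).choose_spec.symm.trans ?_
    rw [RingHom.id_apply, map_smul, map_smul, map_smul]
    exact congrArg _ (exists_metaRep_toL2 g f).choose_spec

theorem toL2_schwartzRep {n : ℕ} (g : Matrix.unitaryGroup (Fin n) ℂ) (f : Sch n) :
    toL2 n (schwartzRep g f) = metaRep n g (toL2 n f) :=
  (exists_metaRep_toL2 g f).choose_spec.symm

theorem schwartzRep_mul_inv {n : ℕ} (g : Matrix.unitaryGroup (Fin n) ℂ) :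
    schwartzRep g ∘ₗ schwartzRep g⁻¹ = LinearMap.id :=
  LinearMap.ext fun f => toL2_injective n <| by
    rw [LinearMap.comp_apply, toL2_schwartzRep, toL2_schwartzRep, LinearMap.id_apply]
    change (metaRep n g * metaRep n g⁻¹) (toL2 n f) = _
    rw [← map_mul, mul_inv_cancel, map_one]
    rfl

theorem coe_inv_apply {n : ℕ} (g : Matrix.unitaryGroup (Fin n) ℂ) (i j : Fin n) :
    (g⁻¹ : Matrix.unitaryGroup (Fin n) ℂ).1 i j = (starRingEnd ℂ) (g.1 j i) := rfl

/-- Pair with a Hermite function: the adjoints are multiplication by `X_k` and substitution by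
`g⁻¹`, and the claim becomes multiplicativity of the substitution. -/
theorem lower_schwartzRep {n : ℕ} (g : Matrix.unitaryGroup (Fin n) ℂ) (k : Fin n) (f : Sch n) :
    lower k (schwartzRep g f) = ∑ j, (starRingEnd ℂ) (g.1 k j) • schwartzRep g (lower j f) := by
  refine toL2_injective n (ext_inner_hermiteL2 fun p => ?_)
  simp only [map_sum, inner_sum, map_smul, inner_smul_right, toL2_schwartzRep,
    inner_metaRep_right, metaRep_hermiteL2]
  rw [hermiteL2_apply, ← inner_raise, ← hermiteFun_mul_X, toL2_schwartzRep, ← hermiteL2_apply,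
    inner_metaRep_right, metaRep_hermiteL2, map_mul, polySubst_X,
    Finset.mul_sum, map_sum, sum_inner]
  refine Finset.sum_congr rfl fun j _ => ?_
  rw [mul_smul_comm, map_smul, inner_smul_left, hermiteL2_apply, hermiteL2_apply,
    hermiteFun_mul_X, inner_raise, coe_inv_apply, Complex.conj_conj]

/-- The same duality, with the chain rule for `∂_k` in place of multiplicativity; unitarity inverts
the chain rule. -/
theorem raise_schwartzRep {n : ℕ} (g : Matrix.unitaryGroup (Fin n) ℂ) (k : Fin n) (f : Sch n) :
    raise k (schwartzRep g f) = ∑ j, g.1 k j • schwartzRep g (raise j f) := by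
  refine toL2_injective n (ext_inner_hermiteL2 fun p => ?_)
  have h : polySubst (g⁻¹ : Matrix.unitaryGroup (Fin n) ℂ) (MvPolynomial.pderiv k p) =
      ∑ j, (starRingEnd ℂ) (g.1 k j) • MvPolynomial.pderiv j
        (polySubst (g⁻¹ : Matrix.unitaryGroup (Fin n) ℂ) p) := by
    simp only [pderiv_polySubst, Finset.smul_sum, smul_smul, coe_inv_apply, Complex.conj_conj]
    rw [Finset.sum_comm]
    have hg : ∀ x, ∑ j, (starRingEnd ℂ) (g.1 k j) * g.1 x j = if k = x then 1 else 0 := fun x => by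
      rw [← sum_mul_conj_unitary g⁻¹]
      simp only [coe_inv_apply, Complex.conj_conj]
    simp only [← Finset.sum_smul, hg, ite_smul, one_smul, zero_smul, Finset.sum_ite_eq,
      Finset.mem_univ, if_true]
  simp only [map_sum, inner_sum, map_smul, inner_smul_right, toL2_schwartzRep,
    inner_metaRep_right, metaRep_hermiteL2]
  rw [hermiteL2_apply, ← inner_lower, lower_hermiteFun, toL2_schwartzRep, ← hermiteL2_apply,
    inner_metaRep_right, metaRep_hermiteL2, map_smul, h, Finset.smul_sum,
    map_sum, sum_inner]
  refine Finset.sum_congr rfl fun j _ => ?_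
  rw [smul_comm, map_smul, inner_smul_left, Complex.conj_conj, hermiteL2_apply, hermiteL2_apply,
    ← lower_hermiteFun, inner_lower]

/-! ### The action of `U(n)` on constant forms -/

theorem formRep_ι_mul {n : ℕ} (g : Matrix.unitaryGroup (Fin n) ℂ) (v : Fin n → ℂ) (α : Ext n) :
    formRep n g (ExteriorAlgebra.ι ℂ v * α) =
      ExteriorAlgebra.ι ℂ (Matrix.vecMul v (g⁻¹ : Matrix.unitaryGroup (Fin n) ℂ)) *
        formRep n g α := by
  change ExteriorAlgebra.map _ _ = _ * ExteriorAlgebra.map _ _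
  rw [map_mul, ExteriorAlgebra.map_apply_ι]
  rfl

/-- The coefficients `(g⁻¹)_jk = conj (g_kj)` are those of `lower_schwartzRep`, summed over the
other index. -/
theorem formRep_wedge {n : ℕ} (g : Matrix.unitaryGroup (Fin n) ℂ) (j : Fin n) (α : Ext n) :
    formRep n g (wedge j α) = ∑ k, (starRingEnd ℂ) (g.1 k j) • wedge k (formRep n g α) := by
  have h : formRep n g (dx j * α) = formRep n g (dx j) * formRep n g α :=
    map_mul (ExteriorAlgebra.map _) _ _
  simp only [wedge, LinearMap.mulLeft_apply]
  rw [h, formRep_dx, Finset.sum_mul]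
  simp only [smul_mul_assoc]
  rfl

/-- Both sides satisfy the same antiderivation rule for multiplication by a covector `v`, since `(v
g⁻¹) g = v`. The coefficients match `raise_schwartzRep`. -/
theorem formRep_contr {n : ℕ} (g : Matrix.unitaryGroup (Fin n) ℂ) (j : Fin n) (α : Ext n) :
    formRep n g (contr j α) = ∑ k, g.1 k j • contr k (formRep n g α) := by
  have hc : ∀ (k : Fin n) (v : Fin n → ℂ) (β : Ext n), contr k (ExteriorAlgebra.ι ℂ v * β) =
      v k • β - ExteriorAlgebra.ι ℂ v * contr k β := fun k v β =>
    CliffordAlgebra.contractLeft_ι_mul (Q := (0 : QuadraticForm ℂ (Fin n → ℂ)))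
      (LinearMap.proj k) v β
  induction α using CliffordAlgebra.left_induction with
  | algebraMap c =>
    have h : formRep n g (algebraMap ℂ (Ext n) c) = algebraMap ℂ (Ext n) c :=
      (ExteriorAlgebra.map _).commutes c
    have h2 : ∀ k : Fin n, contr k (algebraMap ℂ (Ext n) c) = 0 := fun k =>
      CliffordAlgebra.contractLeft_algebraMap (Q := (0 : QuadraticForm ℂ (Fin n → ℂ)))
        (LinearMap.proj k) c
    erw [h, h2]
    simp [h2]
  | add α β hα hβ => simp only [map_add, hα, hβ, smul_add, Finset.sum_add_distrib]
  | ι_mul β v hβ =>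
    change formRep n g (contr j (ExteriorAlgebra.ι ℂ v * β)) =
      ∑ k, g.1 k j • contr k (formRep n g (ExteriorAlgebra.ι ℂ v * β))
    have hv : ∑ k, g.1 k j * Matrix.vecMul v (g⁻¹ : Matrix.unitaryGroup (Fin n) ℂ) k = v j := by
      have h : Matrix.vecMul (Matrix.vecMul v (g⁻¹ : Matrix.unitaryGroup (Fin n) ℂ)) g.1 = v := by
        rw [Matrix.vecMul_vecMul, show (g⁻¹ : Matrix.unitaryGroup (Fin n) ℂ).1 * g.1 = 1 from
          Matrix.UnitaryGroup.star_mul_self g,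
          Matrix.vecMul_one]
      conv_rhs => rw [← h]
      exact Finset.sum_congr rfl fun k _ => mul_comm _ _
    simp only [formRep_ι_mul, hc, smul_sub, smul_smul, Finset.sum_sub_distrib, ← Finset.sum_smul,
      hv, map_sub, map_smul, hβ, Finset.mul_sum, mul_smul_comm]

/-- The graded pieces are suprema of powers of the space of covectors, which the algebra map sends
into itself. -/
theorem formRep_mem_evenOdd {n : ℕ} (g : Matrix.unitaryGroup (Fin n) ℂ) (i : ZMod 2) {α : Ext n}
    (h : α ∈ CliffordAlgebra.evenOdd (0 : QuadraticForm ℂ (Fin n → ℂ)) i) :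
    formRep n g α ∈ CliffordAlgebra.evenOdd (0 : QuadraticForm ℂ (Fin n → ℂ)) i := by
  suffices h2 : (CliffordAlgebra.evenOdd (0 : QuadraticForm ℂ (Fin n → ℂ)) i).map (formRep n g) ≤
      CliffordAlgebra.evenOdd (0 : QuadraticForm ℂ (Fin n → ℂ)) i from
    h2 (Submodule.mem_map_of_mem h)
  simp only [CliffordAlgebra.evenOdd]
  rw [Submodule.map_iSup]
  refine iSup_mono fun k => ?_
  change Submodule.map (ExteriorAlgebra.map _).toLinearMap _ ≤ _
  rw [Submodule.map_pow]
  refine pow_le_pow_left' ?_ _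
  rintro _ ⟨_, ⟨v, rfl⟩, rfl⟩
  exact ⟨_, (ExteriorAlgebra.map_apply_ι _ v).symm⟩

/-! ### Invariance of the Euler operator -/

/-- The diagonal action of `U(n)` on Schwartz forms. -/
def schwartzFormRep {n : ℕ} (g : Matrix.unitaryGroup (Fin n) ℂ) : SchForms n →ₗ[ℂ] SchForms n :=
  TensorProduct.map (schwartzRep g) (formRep n g)

theorem formsToL2_schwartzFormRep {n : ℕ} (g : Matrix.unitaryGroup (Fin n) ℂ) (u : SchForms n) :
    formsToL2 n (schwartzFormRep g u) = rho (metaRep n) g (formsToL2 n u) := by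
  induction u using TensorProduct.induction_on with
  | zero => simp
  | add u v hu hv => simp only [map_add, hu, hv]
  | tmul f α =>
    simp only [schwartzFormRep, formsToL2, TensorProduct.map_tmul, ContinuousLinearMap.coe_coe,
      toL2_schwartzRep, LinearMap.id_apply]
    rfl

theorem schwartzFormRep_mul_inv {n : ℕ} (g : Matrix.unitaryGroup (Fin n) ℂ) (u : SchForms n) :
    schwartzFormRep g (schwartzFormRep g⁻¹ u) = u := by
  have h : formRep n g ∘ₗ formRep n g⁻¹ = LinearMap.id := by
    rw [← Module.End.mul_eq_comp, ← map_mul, mul_inv_cancel, map_one]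
    rfl
  rw [schwartzFormRep, schwartzFormRep, ← LinearMap.comp_apply, ← TensorProduct.map_comp,
    schwartzRep_mul_inv, h, TensorProduct.map_id, LinearMap.id_apply]

/-- The point of the particular combination `𝓔`: `d` and `x dx ∧` join to lowering operators, `d*`
and `(x dx ∧)*` to raising operators. -/
theorem euler_tmul {n : ℕ} (f : Sch n) (α : Ext n) :
    euler n (f ⊗ₜ α) = ∑ j, lower j f ⊗ₜ wedge j α + ∑ j, raise j f ⊗ₜ contr j α := by
  simp only [euler, extD, extDStar, xdxWedge, xdxWedgeStar, LinearMap.add_apply,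
    LinearMap.neg_apply, LinearMap.sum_apply, TensorProduct.map_tmul, ContinuousLinearMap.coe_coe,
    lower_apply, raise_apply, TensorProduct.add_tmul, TensorProduct.sub_tmul,
    Finset.sum_add_distrib, Finset.sum_sub_distrib]
  abel

theorem euler_schwartzFormRep {n : ℕ} (g : Matrix.unitaryGroup (Fin n) ℂ) (u : SchForms n) :
    euler n (schwartzFormRep g u) = schwartzFormRep g (euler n u) := by
  induction u using TensorProduct.induction_on with
  | zero => simp
  | add u v hu hv => simp only [map_add, hu, hv]
  | tmul f α =>
    simp only [schwartzFormRep, TensorProduct.map_tmul, euler_tmul, map_add, map_sum,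
      lower_schwartzRep, raise_schwartzRep, formRep_wedge, formRep_contr, TensorProduct.sum_tmul,
      TensorProduct.tmul_sum, TensorProduct.smul_tmul]
    -- Once the scalars have crossed the tensor product, both sides are the same double sum in
    -- opposite orders.
    congr 1 <;> exact Finset.sum_comm

theorem schwartzFormRep_mem_range {n : ℕ} (g : Matrix.unitaryGroup (Fin n) ℂ) (i : ZMod 2)
    {u : SchForms n} (hu : u ∈ LinearMap.range (TensorProduct.map (LinearMap.id : Sch n →ₗ[ℂ] Sch n)
      (CliffordAlgebra.evenOdd (0 : QuadraticForm ℂ (Fin n → ℂ)) i).subtype)) :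
    schwartzFormRep g u ∈ LinearMap.range (TensorProduct.map (LinearMap.id : Sch n →ₗ[ℂ] Sch n)
      (CliffordAlgebra.evenOdd (0 : QuadraticForm ℂ (Fin n → ℂ)) i).subtype) := by
  obtain ⟨w, rfl⟩ := hu
  induction w using TensorProduct.induction_on with
  | zero => simp
  | add w w' h h' => simpa only [map_add] using add_mem h h'
  | tmul f α => exact ⟨schwartzRep g f ⊗ₜ ⟨_, formRep_mem_evenOdd g i α.2⟩, rfl⟩

end EulerUn

end

theorem mainTheorem6 (n : ℕ) :
    (∃! R : Matrix.unitaryGroup (Fin n) ℂ →* (EulerUn.L2 n ≃ₗᵢ[ℂ] EulerUn.L2 n),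
      EulerUn.IsMetaplecticRep R) ∧
    ∀ R : Matrix.unitaryGroup (Fin n) ℂ →* (EulerUn.L2 n ≃ₗᵢ[ℂ] EulerUn.L2 n),
      EulerUn.IsMetaplecticRep R →
      ∀ (g : Matrix.unitaryGroup (Fin n) ℂ) (u : EulerUn.SchForms n),
        ∃ v : EulerUn.SchForms n,
          EulerUn.rho R g⁻¹ (EulerUn.formsToL2 n u) = EulerUn.formsToL2 n v ∧
          (u ∈ EulerUn.evenForms n → v ∈ EulerUn.evenForms n) ∧
          (u ∈ EulerUn.oddForms n → v ∈ EulerUn.oddForms n) ∧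
          EulerUn.rho R g (EulerUn.formsToL2 n (EulerUn.euler n v)) =
            EulerUn.formsToL2 n (EulerUn.euler n u) := by
  refine ⟨⟨EulerUn.metaRep n, EulerUn.isMetaplecticRep_metaRep n, fun R hR => hR.eq_metaRep⟩,
    fun R hR g u => ?_⟩
  obtain rfl := hR.eq_metaRep
  -- The Schwartz form representing `ρ_g⁻¹ u`; `𝓔` commutes with the action of `g`, which then
  -- undoes that of `g⁻¹`.
  refine ⟨EulerUn.schwartzFormRep g⁻¹ u, (EulerUn.formsToL2_schwartzFormRep _ _).symm,
    EulerUn.schwartzFormRep_mem_range _ 0, EulerUn.schwartzFormRep_mem_range _ 1, ?_⟩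
  rw [← EulerUn.formsToL2_schwartzFormRep, ← EulerUn.euler_schwartzFormRep,
    EulerUn.schwartzFormRep_mul_inv]
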